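/- Let $p$ be a prime and let $\mathbb{F}_p=\{0,1,\dots,p-1\}$ be the field with $p$ elements. Let $(\gamma_j)_{j\ge1}$ be a non-increasing sequence of real numbers with $0<\gamma_j\le1$, put $\gamma_{\mathfrak u}=\prod_{j\in\mathfrak u}\gamma_j$, and let $0=w_1\le w_2\le\cdots$ be integers. *Discrepancy.* For a multiset $\mathcal P=\{\boldsymbol x_0,\dots,\boldsymbol x_{N-1}\}\subseteq[0,1)^s$ and $\boldsymbol t\in(0,1]^s$ let $\Delta(\boldsymbol t,\mathcal P)=\frac1N\#\{n:\boldsymbol x_n\in\prod_{j=1}^s[0,t_j)\}-\prod_{j=1}^st_j$. The weighted star discrepancy is $$D^*_{N,\gamma}(\mathcal P)=\sup_{\boldsymbol t\in(0,1]^s}\max_{\emptyset\ne\mathfrak u\subseteq\{1,\dots,s\}}\gamma_{\mathfrak u}\,|\Delta((\boldsymbol t_{\mathfrak u},\boldsymbol 1),\mathcal P)|,$$ where $(\boldsymbol t_{\mathfrak u},\boldsymbol1)$ has $j$-th entry $t_j$ for $j\in\mathfrak u$ and $1$ otherwise. Let $N^*(s,\varepsilon)$ be the least $N\ge1$ with $\inf_{\mathcal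 P}D^*_{N,\gamma}(\mathcal P)\le\varepsilon$, the infimum being over all $N$-point multisets $\mathcal P\subseteq[0,1)^s$. The weighted star discrepancy is strongly polynomially tractable if there are $C,\tau>0$ with $N^*(s,\varepsilon)\le C\varepsilon^{-\tau}$ for all $s\ge1$ and $\varepsilon\in(0,1)$. *Point sets.* For $m\ge1$, $N=p^m$ and $\boldsymbol q=(q_1,\dots,q_s)\in\mathbb F_p[x]^s$, the polynomial lattice point set $\mathcal P(\boldsymbol q,x^m)$ consists of the points $\boldsymbol x_n=(\phi_m(n(x)q_i(x)/x^m))_{i=1}^s$, $0\le n<p^m$, where $n(x)=\sum_{r<m}n_rx^r$ for $n=\sum_{r<m}n_rp^r$ with digits $n_r\in\{0,\dots,p-1\}$, and $\phi_m(\sum_l t_lx^{-l})=\sum_{l=1}^m t_lp^{-l}$ for formal Laurent series in $x^{-1}$ over $\mathbb F_p$. *Reduced CBC construction.* Let $G_{p,m}$ be the set of polynomials over $\mathbb F_p$ of degree less than $m$. For $h\in G_{p,m}$ and $\gamma>0$ put $r_p(0,\gamma)=1+\gamma$, and $r_p(h,\gamma)=\gamma\,p^{-a-1}\sin^{-2}(\pi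 h_a/p)$ if $h$ has degree $a\ge0$ and leading coefficient $h_a$. For $\boldsymbol q\in\mathbb F_p[x]^d$ let $$R^d_\gamma(\boldsymbol q)=\sum_{\substack{\boldsymbol h\in G_{p,m}^d\setminus\{\boldsymbol0\}\\ x^m\mid h_1q_1+\dots+h_dq_d}}\ \prod_{i=1}^dr_p(h_i,\gamma_i).$$ Let $\mathcal G_{p,m-w}=\{g\in G_{p,m-w}:\gcd(g,x^m)=1\}$ if $w<m$ and $\mathcal G_{p,m-w}=\{1\}$ if $w\ge m$. The reduced CBC construction sets $g_1=1$ and then, for $d=1,\dots,s-1$, chooses $g_{d+1}\in\mathcal G_{p,m-w_{d+1}}$ so that $R^{d+1}_\gamma(x^{w_1}g_1,\dots,x^{w_d}g_d,x^{w_{d+1}}g)$ is minimal at $g=g_{d+1}$ among all $g\in\mathcal G_{p,m-w_{d+1}}$. It always has an output $(g_1,\dots,g_s)$. **Claim.** Suppose $\sum_{j=1}^\infty\gamma_jp^{w_j}<\infty$. Then: 1. The weighted star discrepancy is strongly polynomially tractable, and this is achieved by the reduced CBC construction: there are $C,\tau>0$ such that for all $s\ge1$ and $\varepsilon\in(0,1)$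 there is $m\ge1$ with $p^m\le C\varepsilon^{-\tau}$ such that every output $(g_1,\dots,g_s)$ of the construction satisfies $D^*_{p^m,\gamma}(\mathcal P((x^{w_1}g_1,\dots,x^{w_s}g_s),x^m))\le\varepsilon$. 2. For every $\delta>0$ there is $C_\delta>0$, independent of $s$ and $m$, such that for all $s,m\ge1$, with $N=p^m$, every output $(g_1,\dots,g_s)$ of the construction satisfies $D^*_{N,\gamma}(\mathcal P((x^{w_1}g_1,\dots,x^{w_s}g_s),x^m))\le C_\delta N^{-1+\delta}$. -/

import Mathlib

open scoped Polynomial ENNReal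

namespace PolyLattice

noncomputable section

/-! Sequences `(γ_j)_{j ≥ 1}` and `(w_j)_{j ≥ 1}` are indexed from `0`: the Lean value `γ j` is
`γ_{j+1}`, and the coordinates `1, …, s` are the elements `0, …, s - 1` of `Fin s`. -/

section Discrepancy

/-- The local discrepancy `Δ(t, P)` of the points `P 0, …, P (N - 1)` (repetitions allowed). -/
def localDisc {N s : ℕ} (P : Fin N → Fin s → ℝ) (t : Fin s → ℝ) : ℝ :=
  (1 / (N : ℝ)) * ∑ n, (Set.univ.pi fun j => Set.Ico (0 : ℝ) (t j)).indicator 1 (P n) - ∏ j, t j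

/-- The weighted star discrepancy for the product weights `γ_u = ∏_{j ∈ u} γ_j`. -/
def weightedStarDisc (γ : ℕ → ℝ) {N s : ℕ} (P : Fin N → Fin s → ℝ) : ℝ :=
  ⨆ t : {t : Fin s → ℝ // ∀ j, t j ∈ Set.Ioc (0 : ℝ) 1},
    ⨆ u : {u : Finset (Fin s) // u.Nonempty},
      (∏ j ∈ u.1, γ j) * |localDisc P fun j => if j ∈ u.1 then t.1 j else 1|

/-- The `N`th minimal weighted star discrepancy in dimension `s`. -/
def minDisc (γ : ℕ → ℝ) (N s : ℕ) : ℝ :=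
  ⨅ P : Fin N → Fin s → Set.Ico (0 : ℝ) 1, weightedStarDisc γ fun n j => (P n j : ℝ)

/-- The information complexity `N*(s, ε)`, with value `⊤` if no number of points suffices. -/
def infoComplexity (γ : ℕ → ℝ) (s : ℕ) (ε : ℝ) : ℕ∞ :=
  ⨅ N : {N : ℕ // 1 ≤ N ∧ minDisc γ N s ≤ ε}, (N.1 : ℕ∞)

/-- Strong polynomial tractability of the weighted star discrepancy. -/
def StronglyPolynomiallyTractable (γ : ℕ → ℝ) : Prop :=
  ∃ C > (0 : ℝ), ∃ τ > (0 : ℝ), ∀ s : ℕ, 1 ≤ s → ∀ ε ∈ Set.Ioo (0 : ℝ) 1,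
    (infoComplexity γ s ε : ℝ≥0∞) ≤ ENNReal.ofReal (C * ε ^ (-τ))

end Discrepancy

section PointSets

variable (p : ℕ)

/-- The embedding of `F_p[x]` into `F_p((x⁻¹))`. The latter is realised as Mathlib's Laurent series
in the variable `x⁻¹`, so that `x` is `single (-1) 1` and `L.coeff l` is the coefficient of
`x^{-l}`. -/
def toLaurent (q : (ZMod p)[X]) : LaurentSeries (ZMod p) :=
  q.eval₂ HahnSeries.C (HahnSeries.single (-1 : ℤ) (1 : ZMod p))

/-- The map `φ_m : F_p((x⁻¹)) → [0, 1)`. -/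
def phi (m : ℕ) (L : LaurentSeries (ZMod p)) : ℝ :=
  ∑ l ∈ Finset.Icc 1 m, ((L.coeff (l : ℤ)).val : ℝ) * ((p : ℝ) ^ l)⁻¹

/-- The polynomial `n(x) = ∑_{r < m} n_r x^r` given by the base-`p` digits `n_r` of `n`. -/
def digitPoly (m n : ℕ) : (ZMod p)[X] :=
  ∑ r ∈ Finset.range m, Polynomial.C ((n / p ^ r % p : ℕ) : ZMod p) * Polynomial.X ^ r

/-- The polynomial lattice point set `P(g, f)` for a modulus `f` of degree `m`. -/
def polyLatticePoints [Fact p.Prime] (m : ℕ) (f : (ZMod p)[X]) {s : ℕ} (g : Fin s → (ZMod p)[X]) :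
    Fin (p ^ m) → Fin s → ℝ :=
  fun n j => phi p m (toLaurent p (digitPoly p m n * g j) / toLaurent p f)

end PointSets

section Construction

/-- `G_{p,m}`, the polynomials of degree less than `m`, is finite. -/
instance (p m : ℕ) [Fact p.Prime] : Fintype (Polynomial.degreeLT (ZMod p) m) :=
  Fintype.ofEquiv (Fin m → ZMod p) (Polynomial.degreeLTEquiv (ZMod p) m).toEquiv.symm

/-- `r_p(h)` for `h ≠ 0`. -/
def rp (p : ℕ) (h : (ZMod p)[X]) : ℝ :=
  1 / ((p : ℝ) ^ (h.natDegree + 1) * Real.sin (Real.pi / p * (h.leadingCoeff.val : ℝ)) ^ 2)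

open Classical in
/-- `r_p(h, γ)`. -/
def rpWeighted (p : ℕ) (h : (ZMod p)[X]) (c : ℝ) : ℝ :=
  if h = 0 then 1 + c else c * rp p h

open Classical in
/-- `R_γ^d(g, f)` for a modulus `f` of degree `m`. -/
def Rsum (p : ℕ) [Fact p.Prime] (m : ℕ) (f : (ZMod p)[X]) (γ : ℕ → ℝ) {d : ℕ}
    (g : Fin d → (ZMod p)[X]) : ℝ :=
  ∑ h : Fin d → Polynomial.degreeLT (ZMod p) m with
      h ≠ 0 ∧ f ∣ ∑ i, (h i : (ZMod p)[X]) * g i,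
    ∏ i, rpWeighted p (h i) (γ i)

/-- The reduced search set `𝒢_{p,m-w}(f)`. -/
def searchSet (p m w : ℕ) (f : (ZMod p)[X]) : Set (ZMod p)[X] :=
  if w < m then {g | g.degree < ((m - w : ℕ) : WithBot ℕ) ∧ IsCoprime g f} else {1}

/-- The generating vector `(x^{w_1} g_1, …, x^{w_s} g_s)`. -/
def genVector {p s : ℕ} (w : ℕ → ℕ) (g : Fin s → (ZMod p)[X]) : Fin s → (ZMod p)[X] :=
  fun i => Polynomial.X ^ w i * g i

/-- The first `d + 1` entries of a vector. -/
def initial {α : Type*} {s : ℕ} (v : Fin s → α) (d : Fin s) : Fin (d.1 + 1) → α :=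
  fun i => v (Fin.castLE d.isLt i)

/-- `g` is a possible output of the reduced component-by-component algorithm: `g_1 = 1`, and every
later component minimises, over its search set and with the previous components fixed, the
quantity `R_γ` of the generating vector up to that component. -/
structure IsReducedCBC (p : ℕ) [Fact p.Prime] (m : ℕ) (f : (ZMod p)[X]) (γ : ℕ → ℝ) (w : ℕ → ℕ)
    {s : ℕ} (g : Fin s → (ZMod p)[X]) : Prop where
  mem : ∀ d : Fin s, g d ∈ searchSet p m (w d) f
  first : ∀ d : Fin s, d.1 = 0 → g d = 1
  minimal : ∀ d : Fin s, 1 ≤ d.1 → ∀ q ∈ searchSet p m (w d) f,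
    Rsum p m f γ (initial (genVector w g) d) ≤
      Rsum p m f γ (initial (genVector w (Function.update g d q)) d)

end Construction

end

end PolyLattice

/-! Moving the corners of a box to the grid `p⁻ᵐ ℤ` changes the local discrepancy of a polynomial
lattice by at most `|u| / pᵐ`. For grid boxes, expanding the indicator in Walsh functions and
summing the characters over the lattice leaves only the indices in the dual lattice, so that `γ_u`
times the local discrepancy is at most `R_γ`. Each step of the construction does at least as well as
the average over its search set, and averaging the dual condition over that set bounds `R_γ` by
`p⁻ᵐ ∏ᵢ (1 + γᵢ + O(m) γᵢ p^(wᵢ))`. Since `∑ᵢ γᵢ p^(wᵢ)` converges, all but finitely many factors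
together contribute at most `exp (m η)` with `η` arbitrarily small, and the others only a power of
`m`; hence the product is `O(p^(m δ))` uniformly in the dimension. -/

namespace PolyLattice

open Polynomial Finset

section Digits

variable {p : ℕ}

theorem coeff_digitPoly (m n i : ℕ) :
    (digitPoly p m n).coeff i = if i < m then ((n / p ^ i % p : ℕ) : ZMod p) else 0 := by
  simp [digitPoly, finsetSum_coeff, coeff_X_pow]

theorem digitPoly_mem_degreeLT (m n : ℕ) : digitPoly p m n ∈ degreeLT (ZMod p) m := by
  rw [mem_degreeLT, degree_lt_iff_coeff_zero]
  intro i hi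
  rw [coeff_digitPoly, if_neg hi.not_gt]

theorem digitPoly_add (e k n : ℕ) :
    digitPoly p (e + k) n = digitPoly p e n + X ^ e * digitPoly p k (n / p ^ e) := by
  simp only [digitPoly, sum_range_add, mul_sum, pow_add, Nat.div_div_eq_div_mul, mul_left_comm]

theorem digitPoly_one (n : ℕ) : digitPoly p 1 n = C (n : ZMod p) := by
  simp [digitPoly]

/-- The integer with base-`p` digits `a.coeff 0, …, a.coeff (m - 1)`, least significant first, where
residues are read in `{0, …, p - 1}`. It is the inverse of `digitPoly p m` on `{0, …, p ^ m - 1}`,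
and `p ^ m` times the value of `φ_m` at `a / x ^ m`. -/
def polyVal (p m : ℕ) (a : (ZMod p)[X]) : ℕ :=
  ∑ i ∈ range m, (a.coeff i).val * p ^ i

theorem polyVal_eq_finFunctionFinEquiv [NeZero p] (m : ℕ) (a : (ZMod p)[X]) :
    polyVal p m a =
      finFunctionFinEquiv fun i : Fin m => (⟨(a.coeff i).val, ZMod.val_lt _⟩ : Fin p) := by
  rw [polyVal, finFunctionFinEquiv_apply, sum_range]

theorem polyVal_lt [NeZero p] (m : ℕ) (a : (ZMod p)[X]) : polyVal p m a < p ^ m := by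
  rw [polyVal_eq_finFunctionFinEquiv]
  exact Fin.isLt _

theorem X_pow_dvd_sub_digitPoly_iff [NeZero p] {m n : ℕ} (hn : n < p ^ m) (a : (ZMod p)[X]) :
    X ^ m ∣ a - digitPoly p m n ↔ polyVal p m a = n := by
  have hdigit (i : ℕ) : a.coeff i = ((n / p ^ i % p : ℕ) : ZMod p) ↔
      (a.coeff i).val = n / p ^ i % p := by
    rw [← (ZMod.val_injective p).eq_iff, ZMod.val_natCast_of_lt (Nat.mod_lt _ (NeZero.pos p))]
  calc X ^ m ∣ a - digitPoly p m n ↔ ∀ i < m, (a.coeff i).val = n / p ^ i % p := by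
        rw [X_pow_dvd_iff]
        refine forall₂_congr fun i hi => ?_
        rw [coeff_sub, sub_eq_zero, coeff_digitPoly, if_pos hi, hdigit]
    _ ↔ (fun i : Fin m => (⟨(a.coeff i).val, ZMod.val_lt _⟩ : Fin p)) =
          finFunctionFinEquiv.symm ⟨n, hn⟩ := by
        simp only [funext_iff, Fin.ext_iff, Fin.forall_iff]
        rfl
    _ ↔ polyVal p m a = n := by
        rw [Equiv.eq_symm_apply, Fin.ext_iff, polyVal_eq_finFunctionFinEquiv]

variable [Fact p.Prime]

theorem card_degreeLT (m : ℕ) : Fintype.card (degreeLT (ZMod p) m) = p ^ m := by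
  rw [Fintype.card_congr (degreeLTEquiv (ZMod p) m).toEquiv]
  simp [ZMod.card]

theorem sum_digitPoly {M : Type*} [AddCommMonoid M] (m : ℕ) (F : (ZMod p)[X] → M) :
    ∑ n : Fin (p ^ m), F (digitPoly p m n) = ∑ h : degreeLT (ZMod p) m, F h := by
  let e (n : Fin (p ^ m)) : degreeLT (ZMod p) m := ⟨digitPoly p m n, digitPoly_mem_degreeLT m n⟩
  have he : Function.Bijective e := by
    rw [Fintype.bijective_iff_injective_and_card, card_degreeLT, Fintype.card_fin]
    refine ⟨fun a b hab => Fin.ext ?_, rfl⟩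
    rw [← (X_pow_dvd_sub_digitPoly_iff b.isLt (digitPoly p m a)).1 ?_,
      (X_pow_dvd_sub_digitPoly_iff a.isLt (digitPoly p m a)).1 (by simp)]
    rw [show digitPoly p m a = digitPoly p m b from congrArg Subtype.val hab, sub_self]
    exact dvd_zero _
  exact Fintype.sum_bijective e he _ _ fun _ => rfl

end Digits

section ExponentialSums

theorem sum_range_mul_add {M : Type*} [AddCommMonoid M] (F : ℕ → M) (b q r : ℕ) :
    ∑ n ∈ range (b * q + r), F n =
      ∑ l ∈ range q, ∑ j ∈ range b, F (b * l + j) + ∑ j ∈ range r, F (b * q + j) := by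
  rw [sum_range_add]
  congr 1
  induction q with
  | zero => simp
  | succ q ih => rw [mul_add, mul_one, sum_range_add, ih, sum_range_succ]

theorem norm_sum_range_comp_div_le {E : Type*} [SeminormedAddCommGroup E] {F : ℕ → E} {B : ℝ}
    (hF : ∀ k, ‖∑ n ∈ range k, F n‖ ≤ B) {b : ℕ} (hb : 0 < b) (k : ℕ) :
    ‖∑ n ∈ range k, F (n / b)‖ ≤ b * B := by
  have hr : k % b < b := Nat.mod_lt k hb
  have hblock (l j : ℕ) (hj : j < b) : F ((b * l + j) / b) = F l := by
    rw [Nat.mul_add_div hb, Nat.div_eq_of_lt hj, add_zero]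
  have hsum : ∑ n ∈ range k, F (n / b) = (b - k % b) • ∑ n ∈ range (k / b), F n +
      (k % b) • ∑ n ∈ range (k / b + 1), F n := by
    conv_lhs => rw [← Nat.div_add_mod k b]
    rw [sum_range_mul_add,
      sum_congr rfl fun l _ => sum_congr rfl fun j hj => hblock l j (mem_range.1 hj),
      sum_congr rfl fun j hj => hblock (k / b) j ((mem_range.1 hj).trans hr),
      sum_range_succ, smul_add, ← add_assoc, ← add_smul, Nat.sub_add_cancel hr.le, smul_sum]
    simp only [sum_const, card_range]
  calc ‖∑ n ∈ range k, F (n / b)‖ ≤ (b - k % b : ℕ) * B + (k % b : ℕ) * B := by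
        rw [hsum]
        refine (norm_add_le _ _).trans (add_le_add ?_ ?_) <;>
          exact norm_nsmul_le.trans (mul_le_mul_of_nonneg_left (hF _) (Nat.cast_nonneg _))
    _ = b * B := by rw [← add_mul, ← Nat.cast_add, Nat.sub_add_cancel hr.le]

variable {N : ℕ} [NeZero N] {c : ZMod N}

theorem sin_pi_div_mul_val_pos (hc : c ≠ 0) : 0 < Real.sin (Real.pi / N * c.val) := by
  have hN : (0 : ℝ) < N := by exact_mod_cast NeZero.pos N
  have hc_pos : (0 : ℝ) < c.val := by exact_mod_cast ZMod.val_pos.2 hc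
  have hc_lt : (c.val : ℝ) < N := by exact_mod_cast ZMod.val_lt c
  apply Real.sin_pos_of_pos_of_lt_pi
  · have := Real.pi_pos
    positivity
  · rw [div_mul_eq_mul_div, div_lt_iff₀ hN]
    exact mul_lt_mul_of_pos_left hc_lt Real.pi_pos

theorem stdAddChar_mul_natCast (c : ZMod N) (j : ℕ) :
    ZMod.stdAddChar (c * (j : ZMod N)) = ZMod.stdAddChar c ^ j := by
  rw [← AddChar.map_nsmul_eq_pow, nsmul_eq_mul, mul_comm]

theorem stdAddChar_ne_one (hc : c ≠ 0) : ZMod.stdAddChar c ≠ 1 := by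
  rw [← AddChar.map_zero_eq_one (ZMod.stdAddChar (N := N))]
  exact ZMod.injective_stdAddChar.ne hc

theorem norm_stdAddChar_sub_one (c : ZMod N) :
    ‖ZMod.stdAddChar c - 1‖ = 2 * |Real.sin (Real.pi / N * c.val)| := by
  rw [ZMod.stdAddChar_apply, ZMod.toCircle_apply,
    show 2 * (Real.pi : ℂ) * Complex.I * (c.val : ℂ) / N
      = Complex.I * ((2 * (Real.pi / N * c.val) : ℝ) : ℂ) by push_cast; ring,
    Complex.norm_exp_I_mul_ofReal_sub_one, mul_div_cancel_left₀ _ two_ne_zero, norm_mul,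
    Real.norm_eq_abs, Real.norm_eq_abs, abs_two]

theorem sum_range_stdAddChar_mul (hc : c ≠ 0) :
    ∑ j ∈ range N, ZMod.stdAddChar (c * (j : ZMod N)) = 0 := by
  simp only [stdAddChar_mul_natCast]
  rw [geom_sum_eq (stdAddChar_ne_one hc), ← stdAddChar_mul_natCast]
  simp

theorem norm_sum_range_stdAddChar_mul_le (hc : c ≠ 0) (k : ℕ) :
    ‖∑ j ∈ range k, ZMod.stdAddChar (c * (j : ZMod N))‖ ≤ 1 / Real.sin (Real.pi / N * c.val) := by
  have hsin := sin_pi_div_mul_val_pos hc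
  simp only [stdAddChar_mul_natCast]
  rw [geom_sum_eq (stdAddChar_ne_one hc), norm_div, norm_stdAddChar_sub_one, abs_of_pos hsin,
    div_le_div_iff₀ (by positivity) hsin, one_mul]
  gcongr
  calc ‖ZMod.stdAddChar c ^ k - 1‖ ≤ ‖ZMod.stdAddChar c ^ k‖ + ‖(1 : ℂ)‖ := norm_sub_le _ _
    _ = 2 := by rw [norm_pow, AddChar.norm_apply, one_pow, norm_one]; norm_num

/-- The blocks on which `n / N` is constant are full periods of the character, so only the last,
incomplete one contributes. -/
theorem norm_sum_range_stdAddChar_mul_mul_le (hc : c ≠ 0) {u : ℕ → ℂ} (hu : ∀ n, ‖u n‖ ≤ 1)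
    (k : ℕ) : ‖∑ n ∈ range k, ZMod.stdAddChar (c * (n : ZMod N)) * u (n / N)‖
      ≤ 1 / Real.sin (Real.pi / N * c.val) := by
  have hblock (l j : ℕ) (hj : j < N) :
      ZMod.stdAddChar (c * ((N * l + j : ℕ) : ZMod N)) * u ((N * l + j) / N) =
        ZMod.stdAddChar (c * (j : ZMod N)) * u l := by
    rw [Nat.mul_add_div (NeZero.pos N), Nat.div_eq_of_lt hj, add_zero]
    simp
  have hsum : ∑ n ∈ range k, ZMod.stdAddChar (c * (n : ZMod N)) * u (n / N) =
      (∑ j ∈ range (k % N), ZMod.stdAddChar (c * (j : ZMod N))) * u (k / N) := by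
    conv_lhs => rw [← Nat.div_add_mod k N]
    rw [sum_range_mul_add,
      sum_congr rfl fun l _ => sum_congr rfl fun j hj => hblock l j (mem_range.1 hj),
      sum_congr rfl fun j hj =>
        hblock (k / N) j ((mem_range.1 hj).trans (Nat.mod_lt k (NeZero.pos N)))]
    simp only [← sum_mul, sum_range_stdAddChar_mul hc, zero_mul, sum_const_zero, zero_add]
  rw [hsum, norm_mul]
  exact (mul_le_of_le_one_right (norm_nonneg _) (hu _)).trans
    (norm_sum_range_stdAddChar_mul_le hc _)

end ExponentialSums

section Characters

/-- The additive character `a ↦ ψ (Res (a / x ^ m))` of `F_p[x]`, whose values at the multiples of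
`h` are the Walsh function of index `h`. The residue, the coefficient of `x⁻¹` in `a / x ^ m`, is
read off as the coefficient of `x ^ m` in `x a`, which makes the character trivial for `m = 0`. -/
noncomputable def residueChar (p m : ℕ) [NeZero p] : AddChar (ZMod p)[X] ℂ :=
  ZMod.stdAddChar.compAddMonoidHom
    ((lcoeff (ZMod p) m).toAddMonoidHom.comp (AddMonoidHom.mulLeft X))

section WalshCoeff

variable {p : ℕ} [NeZero p]

theorem residueChar_apply (m : ℕ) (a : (ZMod p)[X]) :
    residueChar p m a = ZMod.stdAddChar ((X * a).coeff m) :=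
  rfl

theorem norm_residueChar (m : ℕ) (a : (ZMod p)[X]) : ‖residueChar p m a‖ = 1 :=
  AddChar.norm_apply ZMod.stdAddChar ((X * a).coeff m)

theorem residueChar_X_pow_mul (e k : ℕ) (a : (ZMod p)[X]) :
    residueChar p (e + k) (X ^ e * a) = residueChar p k a := by
  rw [residueChar_apply, residueChar_apply, mul_left_comm, add_comm, coeff_X_pow_mul]

theorem residueChar_eq_one_of_X_pow_dvd {m : ℕ} {a : (ZMod p)[X]} (h : X ^ m ∣ a) :
    residueChar p m a = 1 := by
  have hdvd : X ^ (m + 1) ∣ X * a := pow_succ' (X : (ZMod p)[X]) m ▸ mul_dvd_mul_left X h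
  rw [residueChar_apply, X_pow_dvd_iff.1 hdvd m m.lt_succ_self, AddChar.map_zero_eq_one]

theorem residueChar_mul_digitPoly_eq_one {m e : ℕ} {h : (ZMod p)[X]} (hm : h.natDegree + e < m)
    (n : ℕ) : residueChar p m (h * digitPoly p e n) = 1 := by
  have hX : (X * h).degree ≤ ((h.natDegree + 1 : ℕ) : WithBot ℕ) :=
    degree_le_of_natDegree_le <| natDegree_mul_le.trans <| by
      rw [add_comm]; gcongr; exact natDegree_X_le
  have hdeg : (X * (h * digitPoly p e n)).degree < (m : WithBot ℕ) := by
    calc (X * (h * digitPoly p e n)).degree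
        ≤ (X * h).degree + (digitPoly p e n).degree := mul_assoc X h _ ▸ degree_mul_le _ _
      _ ≤ ((h.natDegree + 1 : ℕ) : WithBot ℕ) + (digitPoly p e n).degree := by gcongr
      _ < ((h.natDegree + 1 : ℕ) : WithBot ℕ) + e :=
          WithBot.add_lt_add_left WithBot.coe_ne_bot (mem_degreeLT.1 (digitPoly_mem_degreeLT e n))
      _ ≤ m := by exact_mod_cast (by omega : h.natDegree + 1 + e ≤ m)
  rw [residueChar_apply, coeff_eq_zero_of_degree_lt hdeg, AddChar.map_zero_eq_one]

theorem residueChar_succ_mul_C (h : (ZMod p)[X]) (c : ZMod p) :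
    residueChar p (h.natDegree + 1) (h * C c) = ZMod.stdAddChar (h.leadingCoeff * c) := by
  rw [residueChar_apply, coeff_X_mul, coeff_mul_C, leadingCoeff]

/-- The low digits of `n` do not contribute: `h` times their polynomial has small degree. -/
theorem residueChar_mul_digitPoly (h : (ZMod p)[X]) (e n : ℕ) :
    residueChar p (e + (h.natDegree + 1)) (h * digitPoly p (e + (h.natDegree + 1)) n) =
      residueChar p (h.natDegree + 1) (h * digitPoly p (h.natDegree + 1) (n / p ^ e)) := by
  rw [digitPoly_add, mul_add, mul_left_comm, AddChar.map_add_eq_mul, residueChar_X_pow_mul,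
    residueChar_mul_digitPoly_eq_one (by omega), one_mul]

theorem residueChar_succ_mul_digitPoly (h : (ZMod p)[X]) (n : ℕ) :
    residueChar p (h.natDegree + 1) (h * digitPoly p (h.natDegree + 1) n) =
      ZMod.stdAddChar (h.leadingCoeff * (n : ZMod p)) *
        residueChar p h.natDegree (h * digitPoly p h.natDegree (n / p)) := by
  rw [add_comm _ 1, digitPoly_add, digitPoly_one, mul_add, mul_left_comm, AddChar.map_add_eq_mul,
    residueChar_X_pow_mul, pow_one, add_comm, residueChar_succ_mul_C]

theorem norm_sum_range_residueChar_le {h : (ZMod p)[X]} (h0 : h ≠ 0) (e k : ℕ) :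
    ‖∑ n ∈ range k, residueChar p (e + (h.natDegree + 1))
        (h * digitPoly p (e + (h.natDegree + 1)) n)‖
      ≤ p ^ e / Real.sin (Real.pi / p * h.leadingCoeff.val) := by
  have hlead (k : ℕ) :
      ‖∑ n ∈ range k, residueChar p (h.natDegree + 1) (h * digitPoly p (h.natDegree + 1) n)‖
        ≤ 1 / Real.sin (Real.pi / p * h.leadingCoeff.val) := by
    simp only [residueChar_succ_mul_digitPoly]
    exact norm_sum_range_stdAddChar_mul_mul_le (leadingCoeff_ne_zero.2 h0)
      (u := fun l => residueChar p h.natDegree (h * digitPoly p h.natDegree l))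
      (fun _ => (norm_residueChar _ _).le) k
  simp only [residueChar_mul_digitPoly]
  refine (norm_sum_range_comp_div_le hlead (pow_pos (NeZero.pos p) e) k).trans_eq ?_
  rw [Nat.cast_pow, mul_one_div]

/-- The Walsh coefficient with index `h` of the interval `[0, k / p ^ m)`. -/
noncomputable def walshCoeff (p m k : ℕ) [NeZero p] (h : (ZMod p)[X]) : ℂ :=
  ((p : ℂ) ^ m)⁻¹ * ∑ n ∈ range k, residueChar p m (-(h * digitPoly p m n))

theorem walshCoeff_zero (m k : ℕ) : walshCoeff p m k 0 = k / (p : ℂ) ^ m := by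
  simp [walshCoeff, div_eq_inv_mul]

theorem norm_walshCoeff_le_one {m k : ℕ} (hk : k ≤ p ^ m) (h : (ZMod p)[X]) :
    ‖walshCoeff p m k h‖ ≤ 1 := by
  have hp : (0 : ℝ) < p := by exact_mod_cast NeZero.pos p
  rw [walshCoeff, norm_mul, norm_inv, norm_pow, Complex.norm_natCast,
    inv_mul_le_one₀ (pow_pos hp m)]
  calc ‖∑ n ∈ range k, residueChar p m (-(h * digitPoly p m n))‖
      ≤ ∑ n ∈ range k, ‖residueChar p m (-(h * digitPoly p m n))‖ := norm_sum_le _ _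
    _ = k := by simp only [norm_residueChar, sum_const, card_range, nsmul_eq_mul, mul_one]
    _ ≤ (p : ℝ) ^ m := by exact_mod_cast hk

/-- The factor `1 / sin` is weakened to the `1 / sin ^ 2` of `rp`. -/
theorem norm_walshCoeff_le (k : ℕ) {m : ℕ} {h : (ZMod p)[X]} (hh : h ∈ degreeLT (ZMod p) m)
    (h0 : h ≠ 0) : ‖walshCoeff p m k h‖ ≤ rp p h := by
  have hp : (0 : ℝ) < p := by exact_mod_cast NeZero.pos p
  have hdeg : h.natDegree < m := (natDegree_lt_iff_degree_lt h0).2 (mem_degreeLT.1 hh)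
  obtain ⟨e, rfl⟩ := Nat.exists_eq_add_of_le' hdeg
  set S := Real.sin (Real.pi / p * h.leadingCoeff.val) with hS
  have hS_pos : 0 < S := sin_pi_div_mul_val_pos (leadingCoeff_ne_zero.2 h0)
  have hconj (n : ℕ) : residueChar p (e + h.natDegree.succ)
        (-(h * digitPoly p (e + h.natDegree.succ) n)) =
      starRingEnd ℂ (residueChar p (e + h.natDegree.succ)
        (h * digitPoly p (e + h.natDegree.succ) n)) := by
    simp only [residueChar_apply, mul_neg, coeff_neg, AddChar.map_neg_eq_conj]
  calc ‖walshCoeff p (e + h.natDegree.succ) k h‖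
      ≤ ((p : ℝ) ^ (e + h.natDegree.succ))⁻¹ * (p ^ e / S) := by
        rw [walshCoeff, norm_mul, norm_inv, norm_pow, Complex.norm_natCast]
        simp only [hconj, ← map_sum, RCLike.norm_conj]
        gcongr
        exact norm_sum_range_residueChar_le h0 e k
    _ = 1 / ((p : ℝ) ^ (h.natDegree + 1) * S) := by
        rw [pow_add, Nat.succ_eq_add_one]; field_simp
    _ ≤ rp p h := by
        rw [rp, ← hS]
        gcongr
        exact pow_le_of_le_one hS_pos.le (Real.sin_le_one _) two_ne_zero

end WalshCoeff

variable {p : ℕ} [Fact p.Prime]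

theorem X_pow_dvd_of_forall_residueChar_eq_one {m : ℕ} {H : (ZMod p)[X]}
    (h : ∀ a ∈ degreeLT (ZMod p) m, residueChar p m (a * H) = 1) : X ^ m ∣ H := by
  refine X_pow_dvd_iff.2 fun d hd => ?_
  obtain ⟨k, rfl⟩ := Nat.exists_eq_add_of_lt hd
  have hmem : (X ^ k : (ZMod p)[X]) ∈ degreeLT (ZMod p) (d + k + 1) := by
    rw [mem_degreeLT, degree_X_pow]
    exact_mod_cast (by omega : k < d + k + 1)
  have h1 := h _ hmem
  rw [add_right_comm, add_comm, residueChar_X_pow_mul, residueChar_apply, coeff_X_mul,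
    ← AddChar.map_zero_eq_one (ZMod.stdAddChar (N := p))] at h1
  exact ZMod.injective_stdAddChar h1

open Classical in
theorem sum_residueChar_mul (m : ℕ) (H : (ZMod p)[X]) :
    ∑ h : degreeLT (ZMod p) m, residueChar p m (h * H) = if X ^ m ∣ H then (p : ℂ) ^ m else 0 := by
  let χ : AddChar (degreeLT (ZMod p) m) ℂ := (residueChar p m).compAddMonoidHom
    (LinearMap.mulRight (ZMod p) H ∘ₗ (degreeLT (ZMod p) m).subtype).toAddMonoidHom
  have hχ : χ = 0 ↔ X ^ m ∣ H := by
    refine ⟨fun h0 => X_pow_dvd_of_forall_residueChar_eq_one fun a ha => ?_, fun hdvd => ?_⟩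
    · have h1 : χ ⟨a, ha⟩ = 1 := by rw [h0, AddChar.zero_apply]
      exact h1
    · ext h
      exact residueChar_eq_one_of_X_pow_dvd (hdvd.mul_left _)
  have hsum := AddChar.sum_eq_ite χ
  simp only [hχ, card_degreeLT, Nat.cast_pow] at hsum
  exact hsum

theorem walshCoeff_full {m : ℕ} {h : (ZMod p)[X]} (hh : h ∈ degreeLT (ZMod p) m) (h0 : h ≠ 0) :
    walshCoeff p m (p ^ m) h = 0 := by
  have hndvd : ¬ X ^ m ∣ -h := fun hdvd => h0 <|
    eq_zero_of_dvd_of_degree_lt ((dvd_neg (α := (ZMod p)[X])).1 hdvd) <| by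
      rwa [degree_X_pow, ← mem_degreeLT]
  rw [walshCoeff, ← Fin.sum_univ_eq_sum_range fun n => residueChar p m (-(h * digitPoly p m n)),
    sum_digitPoly m fun a => residueChar p m (-(h * a))]
  rw [sum_congr rfl fun a _ => congrArg (residueChar p m) (show -(h * a.1) = a.1 * -h by ring),
    sum_residueChar_mul, if_neg hndvd, mul_zero]

open Classical in
theorem indicator_eq_sum_walshCoeff {m k : ℕ} (hk : k ≤ p ^ m) (a : (ZMod p)[X]) :
    (if polyVal p m a < k then 1 else 0 : ℂ) =
      ∑ h : degreeLT (ZMod p) m, walshCoeff p m k h * residueChar p m (h * a) := by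
  have hp : (p : ℂ) ^ m ≠ 0 := pow_ne_zero _ (NeZero.ne _)
  have horth (n : ℕ) (hn : n ∈ range k) : ∑ h : degreeLT (ZMod p) m,
      residueChar p m (-(h * digitPoly p m n)) * residueChar p m (h * a) =
        if polyVal p m a = n then (p : ℂ) ^ m else 0 := by
    rw [← if_congr (X_pow_dvd_sub_digitPoly_iff ((mem_range.1 hn).trans_le hk) a) rfl rfl,
      ← sum_residueChar_mul]
    refine sum_congr rfl fun h _ => ?_
    rw [← AddChar.map_add_eq_mul, mul_sub, sub_eq_neg_add]
  simp only [walshCoeff, mul_assoc, ← mul_sum, sum_mul]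
  rw [sum_comm, sum_congr rfl horth, sum_ite_eq]
  simp only [mem_range, mul_ite, mul_zero, inv_mul_cancel₀ hp]

end Characters

section Points

variable {p : ℕ}

theorem coeff_toLaurent (a : (ZMod p)[X]) (k : ℕ) : (toLaurent p a).coeff (-k) = a.coeff k := by
  induction a using Polynomial.induction_on' with
  | add a b ha hb =>
    rw [toLaurent, eval₂_add, HahnSeries.coeff_add', Pi.add_apply, coeff_add, ← ha, ← hb,
      toLaurent, toLaurent]
  | monomial n c =>
    rw [toLaurent, eval₂_monomial, HahnSeries.single_pow, HahnSeries.C_apply,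
      HahnSeries.single_mul_single, HahnSeries.coeff_single, coeff_monomial]
    simp [eq_comm]

variable [Fact p.Prime]

theorem toLaurent_div_X_pow (m : ℕ) (a : (ZMod p)[X]) :
    toLaurent p a / toLaurent p (X ^ m) = toLaurent p a * HahnSeries.single (m : ℤ) 1 := by
  have hX : toLaurent p (X ^ m) = HahnSeries.single (-m : ℤ) 1 := by
    rw [toLaurent, eval₂_X_pow, HahnSeries.single_pow]
    simp
  rw [hX, div_eq_mul_inv, HahnSeries.inv_single, neg_neg, inv_one]

theorem coeff_toLaurent_div_X_pow {l m : ℕ} (hl : l ≤ m) (a : (ZMod p)[X]) :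
    (toLaurent p a / toLaurent p (X ^ m)).coeff l = a.coeff (m - l) := by
  rw [toLaurent_div_X_pow, show (l : ℤ) = -((m - l : ℕ) : ℤ) + m by omega,
    HahnSeries.coeff_mul_single_add, mul_one, coeff_toLaurent]

theorem phi_toLaurent_div_X_pow (m : ℕ) (a : (ZMod p)[X]) :
    phi p m (toLaurent p a / toLaurent p (X ^ m)) = polyVal p m a / (p : ℝ) ^ m := by
  have hp : (p : ℝ) ≠ 0 := by exact_mod_cast NeZero.ne p
  rw [phi, polyVal, Nat.cast_sum, sum_div]
  refine sum_nbij' (fun l => m - l) (fun i => m - i) ?_ ?_ ?_ ?_ fun l hl => ?_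
  any_goals simp only [mem_Icc, mem_range]; omega
  have hlm : l ≤ m := (mem_Icc.1 hl).2
  rw [coeff_toLaurent_div_X_pow hlm, Nat.cast_mul, Nat.cast_pow, mul_div_assoc,
    pow_sub₀ _ hp hlm, mul_div_right_comm, div_self (pow_ne_zero m hp), one_mul]

theorem polyLatticePoints_apply (m : ℕ) {s : ℕ} (q : Fin s → (ZMod p)[X]) (n : Fin (p ^ m))
    (j : Fin s) :
    polyLatticePoints p m (X ^ m) q n j = polyVal p m (digitPoly p m n * q j) / (p : ℝ) ^ m :=
  phi_toLaurent_div_X_pow m _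

theorem polyLatticePoints_mem_Ico (m : ℕ) {s : ℕ} (q : Fin s → (ZMod p)[X]) (n : Fin (p ^ m))
    (j : Fin s) : polyLatticePoints p m (X ^ m) q n j ∈ Set.Ico (0 : ℝ) 1 := by
  have hp : (0 : ℝ) < p := by exact_mod_cast NeZero.pos p
  rw [polyLatticePoints_apply]
  refine ⟨by positivity, (div_lt_one (pow_pos hp m)).2 ?_⟩
  exact_mod_cast polyVal_lt m _

theorem polyLatticePoints_mem_Ico_iff (m : ℕ) {s : ℕ} (q : Fin s → (ZMod p)[X]) (n : Fin (p ^ m))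
    (j : Fin s) (k : ℕ) :
    polyLatticePoints p m (X ^ m) q n j ∈ Set.Ico (0 : ℝ) (k / (p : ℝ) ^ m) ↔
      polyVal p m (digitPoly p m n * q j) < k := by
  have hp : (0 : ℝ) < p := by exact_mod_cast NeZero.pos p
  rw [Set.mem_Ico, and_iff_right (polyLatticePoints_mem_Ico m q n j).1, polyLatticePoints_apply,
    div_lt_div_iff_of_pos_right (pow_pos hp m), Nat.cast_lt]

theorem indicator_pi_Ico_polyLatticePoints (m : ℕ) {s : ℕ} (q : Fin s → (ZMod p)[X])
    (n : Fin (p ^ m)) (k : Fin s → ℕ) :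
    (Set.univ.pi fun j => Set.Ico (0 : ℝ) (k j / (p : ℝ) ^ m)).indicator (1 : (Fin s → ℝ) → ℝ)
        (polyLatticePoints p m (X ^ m) q n) =
      ∏ j, if polyVal p m (digitPoly p m n * q j) < k j then 1 else 0 := by
  classical
  simp only [Fintype.prod_boole, Set.indicator_apply, Pi.one_apply, Set.mem_univ_pi,
    polyLatticePoints_mem_Ico_iff]
  congr

theorem addChar_sum_eq_prod {A ι M : Type*} [AddCommMonoid A] [CommMonoid M] (ψ : AddChar A M)
    (u : Finset ι) (f : ι → A) : ψ (∑ i ∈ u, f i) = ∏ i ∈ u, ψ (f i) :=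
  map_prod ψ.toMonoidHom (fun i => Multiplicative.ofAdd (f i)) u

open Classical in
theorem sum_ite_polyVal_eq_sum_dual (m : ℕ) {s : ℕ} (q : Fin s → (ZMod p)[X]) {k : Fin s → ℕ}
    (hk : ∀ j, k j ≤ p ^ m) :
    ((p : ℂ) ^ m)⁻¹ * ∑ n : Fin (p ^ m), ∏ j,
        (if polyVal p m (digitPoly p m n * q j) < k j then 1 else 0 : ℂ) =
      ∑ h : Fin s → degreeLT (ZMod p) m with X ^ m ∣ ∑ i, (h i : (ZMod p)[X]) * q i,
        ∏ j, walshCoeff p m (k j) (h j) := by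
  have hp : (p : ℂ) ^ m ≠ 0 := pow_ne_zero _ (NeZero.ne _)
  have hprod (n : Fin (p ^ m)) :
      ∏ j, (if polyVal p m (digitPoly p m n * q j) < k j then 1 else 0 : ℂ) =
        ∑ h : Fin s → degreeLT (ZMod p) m, (∏ j, walshCoeff p m (k j) (h j)) *
          residueChar p m (digitPoly p m n * ∑ i, (h i : (ZMod p)[X]) * q i) := by
    simp only [indicator_eq_sum_walshCoeff (hk _), Fintype.prod_sum, prod_mul_distrib, mul_sum,
      addChar_sum_eq_prod, mul_left_comm]
  rw [sum_congr rfl fun n _ => hprod n, sum_comm, sum_filter, mul_sum]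
  refine sum_congr rfl fun h _ => ?_
  rw [← mul_sum,
    sum_digitPoly m fun a => residueChar p m (a * ∑ i, (h i : (ZMod p)[X]) * q i),
    sum_residueChar_mul]
  split_ifs
  · rw [mul_comm, mul_assoc, mul_inv_cancel₀ hp, mul_one]
  · rw [mul_zero, mul_zero]

open Classical in
/-- The coefficient of index `h = 0` is the volume of the box, and orthogonality leaves only the
indices in the dual lattice. -/
theorem localDisc_polyLatticePoints (m : ℕ) {s : ℕ} (q : Fin s → (ZMod p)[X]) {k : Fin s → ℕ}
    (hk : ∀ j, k j ≤ p ^ m) :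
    (localDisc (polyLatticePoints p m (X ^ m) q) fun j => k j / (p : ℝ) ^ m : ℂ) =
      ∑ h : Fin s → degreeLT (ZMod p) m with h ≠ 0 ∧ X ^ m ∣ ∑ i, (h i : (ZMod p)[X]) * q i,
        ∏ j, walshCoeff p m (k j) (h j) := by
  have hdual := sum_ite_polyVal_eq_sum_dual m q hk
  rw [← add_sum_erase _ _ (show (0 : Fin s → degreeLT (ZMod p) m) ∈ _ by simp)] at hdual
  simp only [Pi.zero_apply, ZeroMemClass.coe_zero, walshCoeff_zero] at hdual
  simp only [localDisc, indicator_pi_Ico_polyLatticePoints]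
  push_cast [apply_ite Complex.ofReal]
  rw [one_div, hdual, add_sub_cancel_left]
  congr 1
  ext h
  simp

end Points

section Rounding

/-- The least point of the grid `ℕ / N` that is not below `t`. Boxes are rounded outwards to the
grid that carries the point set, where the Walsh expansion of their indicators is finite. -/
noncomputable def gridCeil (N : ℕ) (t : ℝ) : ℝ :=
  ⌈t * N⌉₊ / N

variable {N : ℕ} [NeZero N]

theorem natCast_div_lt_gridCeil_iff (k : ℕ) (t : ℝ) :
    (k / N : ℝ) < gridCeil N t ↔ (k / N : ℝ) < t := by
  have hN : (0 : ℝ) < N := by exact_mod_cast NeZero.pos N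
  rw [gridCeil, div_lt_div_iff_of_pos_right hN, Nat.cast_lt, Nat.lt_ceil, div_lt_iff₀ hN]

theorem le_gridCeil (t : ℝ) : t ≤ gridCeil N t := by
  rw [gridCeil, le_div_iff₀ (by exact_mod_cast NeZero.pos N)]
  exact Nat.le_ceil _

theorem gridCeil_sub_le {t : ℝ} (ht : 0 ≤ t) : gridCeil N t - t ≤ 1 / N := by
  have hN : (0 : ℝ) < N := by exact_mod_cast NeZero.pos N
  rw [gridCeil, sub_le_iff_le_add, div_add' _ _ _ hN.ne', div_le_div_iff_of_pos_right hN, add_comm]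
  exact (Nat.ceil_lt_add_one (by positivity)).le

theorem ceil_mul_le (N : ℕ) {t : ℝ} (ht : t ≤ 1) : ⌈t * N⌉₊ ≤ N :=
  Nat.ceil_le.2 (mul_le_of_le_one_left N.cast_nonneg ht)

theorem gridCeil_le_one (N : ℕ) {t : ℝ} (ht : t ≤ 1) : gridCeil N t ≤ 1 :=
  div_le_one_of_le₀ (by exact_mod_cast ceil_mul_le N ht) N.cast_nonneg

/-- Rounding a box to a grid that contains the points does not change which points it contains. -/
theorem localDisc_sub_localDisc_gridCeil {M s : ℕ} {P : Fin M → Fin s → ℝ}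
    (hP : ∀ n j, ∃ k : ℕ, P n j = k / N) (t : Fin s → ℝ) :
    localDisc P t - localDisc P (fun j => gridCeil N (t j)) = ∏ j, gridCeil N (t j) - ∏ j, t j := by
  have hmem (n : Fin M) (j : Fin s) :
      P n j ∈ Set.Ico 0 (gridCeil N (t j)) ↔ P n j ∈ Set.Ico 0 (t j) := by
    obtain ⟨k, hk⟩ := hP n j
    rw [hk, Set.mem_Ico, Set.mem_Ico, natCast_div_lt_gridCeil_iff]
  simp only [localDisc, Set.indicator, Set.mem_univ_pi, hmem]
  ring

theorem prod_sub_prod_le_sum {ι : Type*} (u : Finset ι) {a b : ι → ℝ} (ha : ∀ i ∈ u, 0 ≤ a i)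
    (hab : ∀ i ∈ u, a i ≤ b i) (hb : ∀ i ∈ u, b i ≤ 1) :
    ∏ i ∈ u, b i - ∏ i ∈ u, a i ≤ ∑ i ∈ u, (b i - a i) := by
  classical
  induction u using Finset.induction_on with
  | empty => simp
  | insert i u hi ih =>
    simp only [forall_mem_insert] at ha hab hb
    rw [prod_insert hi, prod_insert hi, sum_insert hi]
    have hsub := ih ha.2 hab.2 hb.2
    have hb_le : ∏ i ∈ u, b i ≤ 1 :=
      prod_le_one (fun j hj => (ha.2 j hj).trans (hab.2 j hj)) hb.2
    have hprod : ∏ i ∈ u, a i ≤ ∏ i ∈ u, b i := prod_le_prod ha.2 hab.2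
    nlinarith [ha.1, hab.1, hb.1]

theorem prod_gridCeil_sub_prod_le {ι : Type*} [Fintype ι] (u : Finset ι) {t : ι → ℝ}
    (ht : ∀ i, t i ∈ Set.Icc 0 1) (hu : ∀ i ∉ u, t i = 1) :
    |∏ i, gridCeil N (t i) - ∏ i, t i| ≤ #u / N := by
  have hprod (r : ι → ℝ) (hr : ∀ i ∉ u, r i = 1) : ∏ i, r i = ∏ i ∈ u, r i :=
    (prod_subset (subset_univ u) fun i _ hi => hr i hi).symm
  have hone : gridCeil N 1 = 1 := le_antisymm (gridCeil_le_one N le_rfl) (le_gridCeil 1)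
  rw [hprod t hu, hprod (fun i => gridCeil N (t i)) fun i hi => by rw [hu i hi, hone],
    abs_of_nonneg (sub_nonneg.2 <| prod_le_prod (fun i _ => (ht i).1) fun i _ => le_gridCeil _)]
  calc _ ≤ ∑ i ∈ u, (gridCeil N (t i) - t i) :=
        prod_sub_prod_le_sum u (fun i _ => (ht i).1) (fun i _ => le_gridCeil _)
          fun i _ => gridCeil_le_one N (ht i).2
    _ ≤ ∑ _i ∈ u, 1 / (N : ℝ) := sum_le_sum fun i _ => gridCeil_sub_le (ht i).1
    _ = #u / N := by rw [sum_const, nsmul_eq_mul, mul_one_div]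

end Rounding

section DiscrepancyBound

variable {p : ℕ}

theorem rp_nonneg (h : (ZMod p)[X]) : 0 ≤ rp p h := by
  rw [rp]
  positivity

theorem rpWeighted_nonneg (h : (ZMod p)[X]) {c : ℝ} (hc : 0 ≤ c) : 0 ≤ rpWeighted p h c := by
  rw [rpWeighted]
  split_ifs
  · positivity
  · exact mul_nonneg hc (rp_nonneg h)

variable [Fact p.Prime] {m : ℕ}

theorem Rsum_nonneg (f : (ZMod p)[X]) {γ : ℕ → ℝ} (hγ : ∀ j, 0 ≤ γ j) {d : ℕ}
    (g : Fin d → (ZMod p)[X]) : 0 ≤ Rsum p m f γ g :=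
  sum_nonneg fun _ _ => prod_nonneg fun _ _ => rpWeighted_nonneg _ (hγ _)

theorem mul_norm_walshCoeff_le_rpWeighted {k : ℕ} (hk : k ≤ p ^ m) {h : (ZMod p)[X]}
    (hh : h ∈ degreeLT (ZMod p) m) {c : ℝ} (hc : 0 ≤ c) :
    c * ‖walshCoeff p m k h‖ ≤ rpWeighted p h c := by
  rw [rpWeighted]
  split_ifs with h0
  · exact (mul_le_of_le_one_right hc (norm_walshCoeff_le_one hk h)).trans (by linarith)
  · exact mul_le_mul_of_nonneg_left (norm_walshCoeff_le k hh h0) hc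

theorem norm_walshCoeff_full_le_rpWeighted {h : (ZMod p)[X]} (hh : h ∈ degreeLT (ZMod p) m) {c : ℝ}
    (hc : 0 ≤ c) : ‖walshCoeff p m (p ^ m) h‖ ≤ rpWeighted p h c := by
  by_cases h0 : h = 0
  · rw [rpWeighted, if_pos h0]
    exact (norm_walshCoeff_le_one le_rfl h).trans (by linarith)
  · rw [walshCoeff_full hh h0, norm_zero]
    exact rpWeighted_nonneg h hc

theorem prod_mul_abs_localDisc_le_Rsum {γ : ℕ → ℝ} (hγ : ∀ j, 0 ≤ γ j) {s : ℕ}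
    (q : Fin s → (ZMod p)[X]) {u : Finset (Fin s)} {k : Fin s → ℕ} (hk : ∀ j, k j ≤ p ^ m)
    (hu : ∀ j ∉ u, k j = p ^ m) :
    (∏ j ∈ u, γ j) * |localDisc (polyLatticePoints p m (X ^ m) q) fun j => k j / (p : ℝ) ^ m| ≤
      Rsum p m (X ^ m) γ q := by
  classical
  have hfactor (h : degreeLT (ZMod p) m) (j : Fin s) :
      (if j ∈ u then γ j else 1) * ‖walshCoeff p m (k j) h‖ ≤ rpWeighted p h (γ j) := by
    split_ifs with hj
    · exact mul_norm_walshCoeff_le_rpWeighted (hk j) h.2 (hγ j)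
    · rw [one_mul, hu j hj]
      exact norm_walshCoeff_full_le_rpWeighted h.2 (hγ j)
  have hfactor_nonneg (h : degreeLT (ZMod p) m) (j : Fin s) :
      0 ≤ (if j ∈ u then γ j else 1) * ‖walshCoeff p m (k j) h‖ := by
    have := hγ j
    positivity
  rw [← Real.norm_eq_abs, ← Complex.norm_real, localDisc_polyLatticePoints m q hk,
    ← univ_inter u, ← prod_ite_mem]
  refine (mul_le_mul_of_nonneg_left (norm_sum_le _ _) (prod_nonneg fun j _ => ?_)).trans ?_
  · have := hγ j
    positivity
  · rw [mul_sum, Rsum]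
    refine sum_le_sum fun h _ => ?_
    rw [norm_prod, ← prod_mul_distrib]
    exact prod_le_prod (fun j _ => hfactor_nonneg (h j) j) fun j _ => hfactor (h j) j

theorem weightedStarDisc_le {γ : ℕ → ℝ} (hγ : ∀ j, 0 ≤ γ j) {s : ℕ} (q : Fin s → (ZMod p)[X])
    {E : ℝ} (hE : ∀ u : Finset (Fin s), (∏ j ∈ u, γ j) * #u ≤ E) :
    weightedStarDisc γ (polyLatticePoints p m (X ^ m) q) ≤
      Rsum p m (X ^ m) γ q + E / (p : ℝ) ^ m := by
  have hE_nonneg : 0 ≤ E := by simpa using hE ∅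
  have hbound_nonneg : 0 ≤ Rsum p m (X ^ m) γ q + E / (p : ℝ) ^ m :=
    add_nonneg (Rsum_nonneg _ hγ q) (by positivity)
  refine Real.iSup_le (fun ⟨t, ht⟩ => Real.iSup_le (fun ⟨u, _⟩ => ?_) hbound_nonneg) hbound_nonneg
  set t' : Fin s → ℝ := fun j => if j ∈ u then t j else 1
  have ht'_mem (j : Fin s) : t' j ∈ Set.Icc 0 1 := by
    simp only [t']
    split_ifs
    exacts [Set.Ioc_subset_Icc_self (ht j), Set.right_mem_Icc.2 zero_le_one]
  have ht'_one (j : Fin s) (hj : j ∉ u) : t' j = 1 := if_neg hj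
  set P := polyLatticePoints p m (X ^ m) q
  have hgrid : (∏ j ∈ u, γ j) * |localDisc P fun j => gridCeil (p ^ m) (t' j)| ≤
      Rsum p m (X ^ m) γ q := by
    simp only [gridCeil]
    exact_mod_cast prod_mul_abs_localDisc_le_Rsum hγ q (fun j => ceil_mul_le _ (ht'_mem j).2)
      fun j hj => by rw [ht'_one j hj, one_mul, Nat.ceil_natCast]
  have hround : (∏ j ∈ u, γ j) * |localDisc P t' - localDisc P fun j => gridCeil (p ^ m) (t' j)| ≤
      E / (p : ℝ) ^ m := by
    rw [localDisc_sub_localDisc_gridCeil fun n j =>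
      ⟨_, by exact_mod_cast polyLatticePoints_apply m q n j⟩]
    calc _ ≤ (∏ j ∈ u, γ j) * (#u / (p ^ m : ℕ)) := mul_le_mul_of_nonneg_left
          (prod_gridCeil_sub_prod_le u ht'_mem ht'_one) (prod_nonneg fun j _ => hγ j)
      _ ≤ E / (p : ℝ) ^ m := by
        rw [← mul_div_assoc, Nat.cast_pow]
        gcongr
        exact hE u
  calc (∏ j ∈ u, γ j) * |localDisc P t'|
      ≤ (∏ j ∈ u, γ j) * (|localDisc P fun j => gridCeil (p ^ m) (t' j)| +
          |localDisc P t' - localDisc P fun j => gridCeil (p ^ m) (t' j)|) :=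
        mul_le_mul_of_nonneg_left (sub_le_iff_le_add'.1 (abs_sub_abs_le_abs_sub _ _))
          (prod_nonneg fun j _ => hγ j)
    _ ≤ Rsum p m (X ^ m) γ q + E / (p : ℝ) ^ m := by rw [mul_add]; exact add_le_add hgrid hround

end DiscrepancyBound

section Kernel

variable {p : ℕ}

theorem card_le_of_forall_X_pow_dvd_sub [NeZero p] {k e : ℕ} {S : Finset (ZMod p)[X]}
    (hdeg : ∀ g ∈ S, g.degree < ((k + e : ℕ) : WithBot ℕ))
    (hdvd : ∀ g ∈ S, ∀ g' ∈ S, X ^ k ∣ g - g') : #S ≤ p ^ e := by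
  have hcard : p ^ e = #(univ : Finset (Fin e → ZMod p)) := by simp [ZMod.card]
  rw [hcard]
  refine card_le_card_of_injOn (fun g (i : Fin e) => g.coeff (k + i)) (fun _ _ => mem_univ _)
    fun g hg g' hg' heq => Polynomial.ext fun i => ?_
  have hzero {g} (hg : g ∈ S) (hi : k + e ≤ i) : g.coeff i = 0 :=
    (degree_lt_iff_coeff_zero _ _).1 (hdeg g hg) i hi
  rcases lt_or_ge i k with hik | hik
  · simpa only [coeff_sub, sub_eq_zero] using X_pow_dvd_iff.1 (hdvd g hg g' hg') i hik
  · rcases lt_or_ge i (k + e) with hie | hie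
    · simpa only [Nat.add_sub_cancel' hik] using congrFun heq ⟨i - k, by omega⟩
    · rw [hzero hg hie, hzero hg' hie]

/-- The sum `∑_c sin⁻²(π c / p)` over the residues modulo `p`, a uniform bound for the trigonometric
factor of `rp`. The residue `0` contributes `1 / 0 = 0`. -/
noncomputable def sinSum (p : ℕ) [NeZero p] : ℝ :=
  ∑ c : ZMod p, 1 / Real.sin (Real.pi / p * c.val) ^ 2

theorem sinSum_nonneg [NeZero p] : 0 ≤ sinSum p :=
  sum_nonneg fun _ _ => by positivity

theorem rp_le [NeZero p] (h : (ZMod p)[X]) : rp p h ≤ sinSum p / (p : ℝ) ^ (h.natDegree + 1) := by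
  rw [rp, mul_comm, ← div_div]
  gcongr
  exact single_le_sum (f := fun c : ZMod p => 1 / Real.sin (Real.pi / p * c.val) ^ 2)
    (fun _ _ => by positivity) (mem_univ _)

variable [Fact p.Prime]

theorem card_mul_pow_le_of_natDegree_eq {k e : ℕ} {S : Finset (ZMod p)[X]}
    (hS : ∀ g ∈ S, g ≠ 0 ∧ X ^ e ∣ g ∧ g.natDegree = k) : #S * p ^ e ≤ p ^ (k + 1) := by
  rcases S.eq_empty_or_nonempty with rfl | ⟨g₀, hg₀⟩
  · simp
  have hek : e ≤ k := by
    obtain ⟨h0, hdvd, hdeg⟩ := hS g₀ hg₀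
    simpa [hdeg] using natDegree_le_of_dvd hdvd h0
  have hcard : #S ≤ p ^ (k + 1 - e) := by
    refine card_le_of_forall_X_pow_dvd_sub (k := e) (fun g hg => ?_)
      fun g hg g' hg' => dvd_sub (hS g hg).2.1 (hS g' hg').2.1
    rw [← natDegree_lt_iff_degree_lt (hS g hg).1, (hS g hg).2.2]
    omega
  calc #S * p ^ e ≤ p ^ (k + 1 - e) * p ^ e := by gcongr
    _ = p ^ (k + 1) := by rw [← pow_add, Nat.sub_add_cancel (by omega)]

/-- Each of the `m` possible degrees contributes at most `sinSum p / p ^ e`: the decay of `rp`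
cancels the growth of the number of multiples of `X ^ e` of that degree. -/
theorem sum_rp_le_of_X_pow_dvd {m e : ℕ} {S : Finset (degreeLT (ZMod p) m)}
    (hS : ∀ a ∈ S, a ≠ 0 ∧ X ^ e ∣ (a : (ZMod p)[X])) :
    ∑ a ∈ S, rp p a ≤ m * sinSum p / (p : ℝ) ^ e := by
  have hp : (0 : ℝ) < p := by exact_mod_cast NeZero.pos p
  have hS0 {a : degreeLT (ZMod p) m} (ha : a ∈ S) : (a : (ZMod p)[X]) ≠ 0 := by
    simpa using (hS a ha).1
  have hmaps : ∀ a ∈ S, (a : (ZMod p)[X]).natDegree ∈ range m := fun a ha => by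
    rw [mem_range, natDegree_lt_iff_degree_lt (hS0 ha)]
    exact mem_degreeLT.1 a.2
  set T : ℕ → Finset (degreeLT (ZMod p) m) := fun k => {a ∈ S | (a : (ZMod p)[X]).natDegree = k}
  have hT (k : ℕ) : ∑ a ∈ T k, rp p a ≤ sinSum p / (p : ℝ) ^ e := by
    have hcard : #(T k) * p ^ e ≤ p ^ (k + 1) := by
      rw [← card_map (Function.Embedding.subtype (· ∈ degreeLT (ZMod p) m))]
      refine card_mul_pow_le_of_natDegree_eq fun g hg => ?_
      obtain ⟨a, ha, rfl⟩ := mem_map.1 hg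
      obtain ⟨haS, hak⟩ := mem_filter.1 ha
      exact ⟨hS0 haS, (hS a haS).2, hak⟩
    calc ∑ a ∈ T k, rp p a ≤ #(T k) • (sinSum p / (p : ℝ) ^ (k + 1)) :=
          sum_le_card_nsmul _ _ _ fun a ha => (mem_filter.1 ha).2 ▸ rp_le a.1
      _ = #(T k) * sinSum p / (p : ℝ) ^ (k + 1) := by rw [nsmul_eq_mul, mul_div_assoc]
      _ ≤ sinSum p / (p : ℝ) ^ e := by
        rw [div_le_div_iff₀ (by positivity) (by positivity), mul_right_comm, mul_comm (sinSum p)]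
        exact mul_le_mul_of_nonneg_right (by exact_mod_cast hcard) sinSum_nonneg
  calc ∑ a ∈ S, rp p a = ∑ k ∈ range m, ∑ a ∈ T k, rp p a :=
        (sum_fiberwise_of_maps_to hmaps _).symm
    _ ≤ ∑ _k ∈ range m, sinSum p / (p : ℝ) ^ e := sum_le_sum fun k _ => hT k
    _ = m * sinSum p / (p : ℝ) ^ e := by rw [sum_const, card_range, nsmul_eq_mul, mul_div_assoc]

end Kernel

section SearchSet

variable {p : ℕ} [Fact p.Prime]

theorem one_mem_searchSet (m w : ℕ) (f : (ZMod p)[X]) : 1 ∈ searchSet p m w f := by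
  rw [searchSet]
  split_ifs with h
  · refine ⟨?_, isCoprime_one_left⟩
    rw [degree_one]
    exact_mod_cast Nat.sub_pos_of_lt h
  · rfl

theorem searchSet_finite (m w : ℕ) (f : (ZMod p)[X]) : (searchSet p m w f).Finite := by
  rw [searchSet]
  split_ifs
  · refine Set.Finite.subset (Set.finite_range ((↑) : degreeLT (ZMod p) (m - w) → (ZMod p)[X]))
      fun g hg => ⟨⟨g, mem_degreeLT.2 hg.1⟩, rfl⟩
  · exact Set.finite_singleton 1

/-- The search set `𝒢_{p,m-w}` for the modulus `x^m` as a `Finset`, over which one can average. -/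
noncomputable def searchFinset (p m w : ℕ) [Fact p.Prime] : Finset (ZMod p)[X] :=
  (searchSet_finite m w (X ^ m)).toFinset

theorem mem_searchFinset {m w : ℕ} {g : (ZMod p)[X]} :
    g ∈ searchFinset p m w ↔ g ∈ searchSet p m w (X ^ m) :=
  Set.Finite.mem_toFinset _

theorem card_searchFinset_pos (m w : ℕ) : 0 < #(searchFinset p m w) :=
  card_pos.2 ⟨1, mem_searchFinset.2 (one_mem_searchSet m w _)⟩

theorem degree_lt_of_mem_searchFinset {m w : ℕ} (h : w < m) {g : (ZMod p)[X]}
    (hg : g ∈ searchFinset p m w) : g.degree < ((m - w : ℕ) : WithBot ℕ) := by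
  rw [mem_searchFinset, searchSet, if_pos h] at hg
  exact hg.1

theorem X_pow_dvd_mul_iff_of_mem_searchFinset {m w : ℕ} (h : w < m) {g : (ZMod p)[X]}
    (hg : g ∈ searchFinset p m w) (k : ℕ) {a : (ZMod p)[X]} : X ^ k ∣ a * g ↔ X ^ k ∣ a := by
  rw [mem_searchFinset, searchSet, if_pos h] at hg
  have hcop : IsCoprime g X := (IsCoprime.pow_right_iff (by omega)).1 hg.2
  exact ⟨hcop.symm.pow_left.dvd_of_dvd_mul_right, fun hdvd => hdvd.mul_right g⟩

theorem pow_le_card_searchFinset {m w : ℕ} (h : w < m) :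
    p ^ (m - w - 1) ≤ #(searchFinset p m w) := by
  rw [← card_degreeLT (p := p) (m - w - 1), ← card_univ]
  refine card_le_card_of_injOn (fun b => 1 + X * (b : (ZMod p)[X])) (fun b _ => ?_)
    fun a _ b _ hab => Subtype.ext (mul_left_cancel₀ X_ne_zero (add_left_cancel hab))
  rw [mem_coe, mem_searchFinset, searchSet, if_pos h]
  refine ⟨(degree_lt_iff_coeff_zero _ _).2 fun i hi => ?_, IsCoprime.pow_right ⟨1, -b, by ring⟩⟩
  obtain ⟨i, rfl⟩ : ∃ j, i = j + 1 := ⟨i - 1, by omega⟩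
  rw [coeff_add, coeff_X_mul, coeff_one, if_neg i.succ_ne_zero, zero_add]
  exact (degree_lt_iff_coeff_zero _ _).1 (mem_degreeLT.1 b.2) i (by omega)

theorem X_pow_dvd_X_pow_mul_iff {R : Type*} [CommRing R] [IsDomain R] {m w : ℕ} (h : w ≤ m)
    {c : R[X]} : X ^ m ∣ X ^ w * c ↔ X ^ (m - w) ∣ c := by
  rw [← Nat.add_sub_cancel' h, pow_add, mul_dvd_mul_iff_left (pow_ne_zero w X_ne_zero),
    Nat.add_sub_cancel_left]

theorem card_le_of_forall_X_pow_dvd_add_mul {n e : ℕ} (he : e ≤ n) {H a : (ZMod p)[X]}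
    (ha : X ^ e ∣ a) (ha' : ¬ X ^ (e + 1) ∣ a) {S : Finset (ZMod p)[X]}
    (hdeg : ∀ g ∈ S, g.degree < (n : WithBot ℕ)) (hS : ∀ g ∈ S, X ^ n ∣ H + a * g) :
    #S ≤ p ^ e := by
  obtain ⟨b, rfl⟩ := ha
  have hcop : IsCoprime (X ^ (n - e)) b := by
    refine IsCoprime.pow_left (irreducible_X.coprime_iff_not_dvd.2 fun hb => ha' ?_)
    rw [pow_succ]
    exact mul_dvd_mul_left _ hb
  refine card_le_of_forall_X_pow_dvd_sub (k := n - e) (by rwa [Nat.sub_add_cancel he])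
    fun g hg g' hg' => hcop.dvd_of_dvd_mul_left ((X_pow_dvd_X_pow_mul_iff he).1 ?_)
  rw [← mul_assoc, mul_sub, ← add_sub_add_left_eq_sub _ _ H]
  exact dvd_sub (hS g hg) (hS g' hg')

open Classical in
/-- The exponent `e` is the multiplicity of `X` in `H`, capped at `m - w`: since the elements of the
search set are coprime to `X`, every solvable `a` must have the same multiplicity. -/
theorem exists_X_pow_dvd_and_card_mul_pow_le_of_lt {m w : ℕ} (hw : w < m) (H : (ZMod p)[X]) :
    ∃ e, ∀ a, {g ∈ searchFinset p m w | X ^ (m - w) ∣ H + a * g}.Nonempty →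
      X ^ e ∣ a ∧ #{g ∈ searchFinset p m w | X ^ (m - w) ∣ H + a * g} * p ^ m ≤
        #(searchFinset p m w) * p ^ (e + w + 1) := by
  have hiff {a : (ZMod p)[X]}
      (ha : {g ∈ searchFinset p m w | X ^ (m - w) ∣ H + a * g}.Nonempty) {k : ℕ}
      (hk : k ≤ m - w) : X ^ k ∣ a ↔ X ^ k ∣ H := by
    obtain ⟨g, hg⟩ := ha
    obtain ⟨hgF, hdvd⟩ := mem_filter.1 hg
    rw [← X_pow_dvd_mul_iff_of_mem_searchFinset hw hgF]
    have hdvd' := (pow_dvd_pow X hk).trans hdvd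
    exact ⟨fun h => (dvd_add_left h).1 hdvd', fun h => (dvd_add_right h).1 hdvd'⟩
  by_cases hH : X ^ (m - w) ∣ H
  · refine ⟨m - w, fun a ha => ⟨(hiff ha le_rfl).2 hH, ?_⟩⟩
    gcongr
    · exact filter_subset _ _
    · exact NeZero.one_le
    · omega
  · obtain ⟨e, he, hdvd, hnot⟩ : ∃ e < m - w, X ^ e ∣ H ∧ ¬ X ^ (e + 1) ∣ H := by
      obtain ⟨e, hdvd, hnot⟩ := Nat.exists_not_and_succ_of_not_zero_of_exists
        (p := fun k => ¬ X ^ k ∣ H) (by simp) ⟨_, hH⟩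
      rw [not_not] at hdvd
      exact ⟨e, not_le.1 fun hle => hH ((pow_dvd_pow X hle).trans hdvd), hdvd, hnot⟩
    refine ⟨e, fun a ha => ⟨(hiff ha he.le).2 hdvd, ?_⟩⟩
    have hcard : #{g ∈ searchFinset p m w | X ^ (m - w) ∣ H + a * g} ≤ p ^ e :=
      card_le_of_forall_X_pow_dvd_add_mul he.le ((hiff ha he.le).2 hdvd)
        (fun h => hnot ((hiff ha he).1 h))
        (fun g hg => degree_lt_of_mem_searchFinset hw (mem_filter.1 hg).1)
        fun g hg => (mem_filter.1 hg).2
    calc _ ≤ p ^ e * p ^ m := by gcongr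
      _ = p ^ (m - w - 1) * p ^ (e + w + 1) := by
        rw [← pow_add, ← pow_add]
        congr 1
        omega
      _ ≤ _ := by
        gcongr
        exact pow_le_card_searchFinset hw

open Classical in
theorem exists_X_pow_dvd_and_card_mul_pow_le (m w : ℕ) (H : (ZMod p)[X]) :
    ∃ e, ∀ a, {g ∈ searchFinset p m w | X ^ m ∣ H + a * (X ^ w * g)}.Nonempty →
      X ^ e ∣ a ∧ #{g ∈ searchFinset p m w | X ^ m ∣ H + a * (X ^ w * g)} * p ^ m ≤
        #(searchFinset p m w) * p ^ (e + w + 1) := by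
  rcases le_or_gt m w with hw | hw
  · refine ⟨0, fun a _ => ⟨by simp, ?_⟩⟩
    gcongr
    · exact filter_subset _ _
    · exact NeZero.one_le
    · omega
  by_cases hH : X ^ w ∣ H
  · obtain ⟨H, rfl⟩ := hH
    simp only [mul_left_comm _ (X ^ w), ← mul_add, X_pow_dvd_X_pow_mul_iff hw.le]
    exact exists_X_pow_dvd_and_card_mul_pow_le_of_lt hw H
  · refine ⟨0, fun a ⟨g, hg⟩ => absurd ?_ hH⟩
    refine (dvd_add_left ?_).1 ((pow_dvd_pow X hw.le).trans (mem_filter.1 hg).2)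
    exact (dvd_mul_right _ _).mul_left a

open Classical in
theorem sum_rp_mul_card_le (m w : ℕ) (H : (ZMod p)[X]) :
    ∑ a : degreeLT (ZMod p) m with a ≠ 0,
        rp p a * #{g ∈ searchFinset p m w | X ^ m ∣ H + (a : (ZMod p)[X]) * (X ^ w * g)} ≤
      #(searchFinset p m w) * ((p : ℝ) ^ w * (p * (m * sinSum p)) / (p : ℝ) ^ m) := by
  have hp : (0 : ℝ) < p := by exact_mod_cast NeZero.pos p
  set F := searchFinset p m w
  obtain ⟨e, he⟩ := exists_X_pow_dvd_and_card_mul_pow_le m w H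
  set B : ℝ := #F * (p : ℝ) ^ (e + w + 1) / (p : ℝ) ^ m
  set S : Finset (degreeLT (ZMod p) m) := {a | a ≠ 0 ∧ X ^ e ∣ (a : (ZMod p)[X])}
  have hterm (a : degreeLT (ZMod p) m) :
      rp p a * #{g ∈ F | X ^ m ∣ H + (a : (ZMod p)[X]) * (X ^ w * g)} ≤
        if X ^ e ∣ (a : (ZMod p)[X]) then rp p a * B else 0 := by
    rcases eq_empty_or_nonempty {g ∈ F | X ^ m ∣ H + (a : (ZMod p)[X]) * (X ^ w * g)}
      with hempty | hne
    · rw [hempty, card_empty, Nat.cast_zero, mul_zero]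
      have := rp_nonneg (a : (ZMod p)[X])
      positivity
    · obtain ⟨hdvd, hcard⟩ := he a hne
      rw [if_pos hdvd]
      refine mul_le_mul_of_nonneg_left ((le_div_iff₀ (by positivity)).2 ?_) (rp_nonneg _)
      exact_mod_cast hcard
  calc _ ≤ ∑ a : degreeLT (ZMod p) m with a ≠ 0,
        if X ^ e ∣ (a : (ZMod p)[X]) then rp p a * B else 0 := sum_le_sum fun a _ => hterm a
    _ = (∑ a ∈ S, rp p a) * B := by rw [← sum_filter, filter_filter, sum_mul]
    _ ≤ m * sinSum p / (p : ℝ) ^ e * B :=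
      mul_le_mul_of_nonneg_right (sum_rp_le_of_X_pow_dvd fun a ha => (mem_filter.1 ha).2)
        (by positivity)
    _ = #F * ((p : ℝ) ^ w * (p * (m * sinSum p)) / (p : ℝ) ^ m) := by
      simp only [B, pow_succ, pow_add]
      field_simp

end SearchSet

section Increment

variable {p : ℕ} [Fact p.Prime]

open Classical in
theorem sum_rpWeighted_mul (m : ℕ) (c : ℝ) (G : degreeLT (ZMod p) m → ℝ) :
    ∑ a : degreeLT (ZMod p) m, rpWeighted p a c * G a =
      (1 + c) * G 0 + c * ∑ a : degreeLT (ZMod p) m with a ≠ 0, rp p a * G a := by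
  rw [← add_sum_erase _ _ (mem_univ 0), mul_sum]
  refine congrArg₂ (· + ·) (by simp [rpWeighted]) (sum_congr (by ext; simp) fun a ha => ?_)
  have ha0 : (a : (ZMod p)[X]) ≠ 0 := by simpa using (mem_filter.1 ha).2
  rw [rpWeighted, if_neg ha0, mul_assoc]

theorem sum_rpWeighted_le (m : ℕ) {c : ℝ} (hc : 0 ≤ c) :
    ∑ a : degreeLT (ZMod p) m, rpWeighted p a c ≤ 1 + c + c * (m * sinSum p) := by
  classical
  have hmul := sum_rpWeighted_mul (p := p) m c 1
  simp only [Pi.one_apply, mul_one] at hmul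
  rw [hmul]
  gcongr
  simpa using sum_rp_le_of_X_pow_dvd (p := p) (m := m) (e := 0) (S := {a | a ≠ 0}) (by simp)

open Classical in
/-- The factor of `γ d` in the recursion `Rsum_snoc` for appending the component `q` to `v`: the
sum over the dual vectors with nonzero last entry. -/
noncomputable def dualIncrement (p : ℕ) [Fact p.Prime] (m : ℕ) (f : (ZMod p)[X]) (γ : ℕ → ℝ) {d : ℕ}
    (v : Fin d → (ZMod p)[X]) (q : (ZMod p)[X]) : ℝ :=
  ∑ h : Fin d → degreeLT (ZMod p) m, (∏ i, rpWeighted p (h i) (γ i)) *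
    ∑ a : degreeLT (ZMod p) m with a ≠ 0, rp p a *
      if f ∣ ∑ i, (h i : (ZMod p)[X]) * v i + (a : (ZMod p)[X]) * q then 1 else 0

open Classical in
theorem sum_ite_mul_rpWeighted (m : ℕ) (c b : ℝ) (Z : Prop) (D : degreeLT (ZMod p) m → Prop) :
    (∑ a : degreeLT (ZMod p) m, if ¬ (Z ∧ a = 0) ∧ D a then b * rpWeighted p a c else 0) =
      (1 + c) * (if ¬ Z ∧ D 0 then b else 0) +
        c * (b * ∑ a : degreeLT (ZMod p) m with a ≠ 0, rp p a * if D a then 1 else 0) := by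
  have hmul := sum_rpWeighted_mul (p := p) m c fun a => if ¬ (Z ∧ a = 0) ∧ D a then b else 0
  simp only [and_true] at hmul
  rw [mul_sum (a := b)]
  refine (sum_congr rfl fun a _ => ?_).trans (hmul.trans ?_)
  · rw [mul_ite, mul_zero, mul_comm]
  · refine congrArg₂ (· + ·) rfl (congrArg (c * ·) (sum_congr rfl fun a ha => ?_))
    simp [(mem_filter.1 ha).2, mul_comm]

theorem Rsum_snoc (m : ℕ) (f : (ZMod p)[X]) (γ : ℕ → ℝ) {d : ℕ} (v : Fin d → (ZMod p)[X])
    (q : (ZMod p)[X]) :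
    Rsum p m f γ (Fin.snoc v q : Fin (d + 1) → (ZMod p)[X]) =
      (1 + γ d) * Rsum p m f γ v + γ d * dualIncrement p m f γ v q := by
  classical
  have hsnoc (h : Fin d → degreeLT (ZMod p) m) (a : degreeLT (ZMod p) m) :
      (Fin.snoc h a : Fin (d + 1) → degreeLT (ZMod p) m) ≠ 0 ↔ ¬ (h = 0 ∧ a = 0) := by
    simp [funext_iff, Fin.forall_fin_succ']
  rw [Rsum, sum_filter, ← (Fin.snocEquiv fun _ : Fin (d + 1) => degreeLT (ZMod p) m).sum_comp,
    Fintype.sum_prod_type_right, Rsum, sum_filter, dualIncrement, mul_sum, mul_sum,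
    ← sum_add_distrib]
  refine sum_congr rfl fun h _ => ?_
  have hfiber := sum_ite_mul_rpWeighted (p := p) m (γ d) (∏ i, rpWeighted p (h i) (γ i)) (h = 0)
    fun a => f ∣ ∑ i, (h i : (ZMod p)[X]) * v i + (a : (ZMod p)[X]) * q
  simp only [ZeroMemClass.coe_zero, zero_mul, add_zero] at hfiber
  simp only [Fin.snocEquiv, Equiv.coe_fn_mk, Fin.sum_univ_castSucc, Fin.prod_univ_castSucc,
    Fin.snoc_castSucc, Fin.snoc_last, Fin.val_castSucc, Fin.val_last, hsnoc]
  convert hfiber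

theorem sum_dualIncrement_le (m w : ℕ) {γ : ℕ → ℝ} (hγ : ∀ j, 0 ≤ γ j) {d : ℕ}
    (v : Fin d → (ZMod p)[X]) :
    ∑ q ∈ searchFinset p m w, dualIncrement p m (X ^ m) γ v (X ^ w * q) ≤
      #(searchFinset p m w) * ((∏ i : Fin d, (1 + γ i + γ i * (m * sinSum p))) *
        ((p : ℝ) ^ w * (p * (m * sinSum p)) / (p : ℝ) ^ m)) := by
  classical
  set F := searchFinset p m w
  set B := (p : ℝ) ^ w * (p * (m * sinSum p)) / (p : ℝ) ^ m
  have hB : 0 ≤ B := by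
    have := sinSum_nonneg (p := p)
    positivity
  have hprod_nonneg (h : Fin d → degreeLT (ZMod p) m) : 0 ≤ ∏ i, rpWeighted p (h i) (γ i) :=
    prod_nonneg fun i _ => rpWeighted_nonneg _ (hγ i)
  calc ∑ q ∈ F, dualIncrement p m (X ^ m) γ v (X ^ w * q)
      = ∑ h : Fin d → degreeLT (ZMod p) m, (∏ i, rpWeighted p (h i) (γ i)) *
          ∑ a : degreeLT (ZMod p) m with a ≠ 0, rp p a *
            #{q ∈ F | X ^ m ∣
              ∑ i, (h i : (ZMod p)[X]) * v i + (a : (ZMod p)[X]) * (X ^ w * q)} := by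
        simp only [dualIncrement]
        rw [sum_comm]
        refine sum_congr rfl fun h _ => ?_
        rw [← mul_sum, sum_comm]
        simp only [← mul_sum, sum_boole]
    _ ≤ ∑ h : Fin d → degreeLT (ZMod p) m, (∏ i, rpWeighted p (h i) (γ i)) * (#F * B) :=
        sum_le_sum fun h _ => mul_le_mul_of_nonneg_left (sum_rp_mul_card_le m w _) (hprod_nonneg h)
    _ = (∏ i : Fin d, ∑ a : degreeLT (ZMod p) m, rpWeighted p a (γ i)) * (#F * B) := by
        rw [← sum_mul, Fintype.prod_sum]
    _ ≤ (∏ i : Fin d, (1 + γ i + γ i * (m * sinSum p))) * (#F * B) :=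
        mul_le_mul_of_nonneg_right (prod_le_prod
          (fun i _ => sum_nonneg fun a _ => rpWeighted_nonneg _ (hγ i))
          fun i _ => sum_rpWeighted_le m (hγ i)) (by positivity)
    _ = #F * ((∏ i : Fin d, (1 + γ i + γ i * (m * sinSum p))) * B) := mul_left_comm _ _ _

theorem le_of_forall_le_Rsum_snoc (m w : ℕ) {γ : ℕ → ℝ} (hγ : ∀ j, 0 ≤ γ j) {d : ℕ}
    (v : Fin d → (ZMod p)[X]) {r : ℝ}
    (hr : ∀ q ∈ searchSet p m w (X ^ m), r ≤
      Rsum p m (X ^ m) γ (Fin.snoc v (X ^ w * q) : Fin (d + 1) → (ZMod p)[X])) :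
    r ≤ (1 + γ d) * Rsum p m (X ^ m) γ v + γ d *
      ((∏ i : Fin d, (1 + γ i + γ i * (m * sinSum p))) *
        ((p : ℝ) ^ w * (p * (m * sinSum p)) / (p : ℝ) ^ m)) := by
  set F := searchFinset p m w
  have hF : (0 : ℝ) < #F := by exact_mod_cast card_searchFinset_pos m w
  refine le_of_mul_le_mul_left ?_ hF
  calc #F * r ≤ ∑ q ∈ F, Rsum p m (X ^ m) γ
          (Fin.snoc v (X ^ w * q) : Fin (d + 1) → (ZMod p)[X]) := by
        rw [← nsmul_eq_mul]
        exact card_nsmul_le_sum F _ r fun q hq => hr q (mem_searchFinset.1 hq)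
    _ = #F * ((1 + γ d) * Rsum p m (X ^ m) γ v) +
          γ d * ∑ q ∈ F, dualIncrement p m (X ^ m) γ v (X ^ w * q) := by
        simp only [Rsum_snoc, sum_add_distrib, sum_const, nsmul_eq_mul, mul_sum]
    _ ≤ _ := by
        rw [mul_add, mul_left_comm _ (γ d)]
        exact add_le_add_right (mul_le_mul_of_nonneg_left (sum_dualIncrement_le m w hγ v) (hγ d)) _

end Increment

section Construction

theorem prod_one_add_add_mul_le_prod {ι : Type*} {a b : ι → ℝ} (ha : ∀ i, 0 ≤ a i)
    (hb : ∀ i, 1 ≤ b i) {x : ℝ} (hx : 0 ≤ x) (u : Finset ι) :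
    ∏ i ∈ u, (1 + a i + a i * x) ≤ ∏ i ∈ u, (1 + a i + a i * (b i * x)) := by
  refine prod_le_prod (fun i _ => ?_) fun i _ => ?_
  · have := ha i
    positivity
  · gcongr
    · exact ha i
    · exact le_mul_of_one_le_left hx (hb i)

variable {p : ℕ}

theorem genVector_update (w : ℕ → ℕ) {s : ℕ} (g : Fin s → (ZMod p)[X]) (d : Fin s)
    (q : (ZMod p)[X]) :
    genVector w (Function.update g d q) = Function.update (genVector w g) d (X ^ w d * q) := by
  funext i
  rcases eq_or_ne i d with rfl | hi
  · simp [genVector]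
  · simp [genVector, hi]

theorem initial_eq_snoc {α : Type*} {s : ℕ} (v : Fin s → α) (d : Fin s) :
    initial v d = Fin.snoc (Fin.take d d.isLt.le v) (v d) :=
  Fin.take_succ_eq_snoc d d.isLt v

theorem initial_update {α : Type*} {s : ℕ} (v : Fin s → α) (d : Fin s) (x : α) :
    initial (Function.update v d x) d = Fin.snoc (Fin.take d d.isLt.le v) x := by
  rw [initial_eq_snoc, Function.update_self, Fin.take_update_of_ge _ _ _ _ le_rfl]

theorem initial_snoc_castSucc {α : Type*} {s : ℕ} (v : Fin s → α) (x : α) (d : Fin s) :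
    initial (Fin.snoc v x : Fin (s + 1) → α) d.castSucc = initial v d :=
  funext fun i => Fin.snoc_castSucc (α := fun _ => α) x v (Fin.castLE d.isLt i)

variable [Fact p.Prime]

theorem Rsum_X_pow_mul_of_mem_searchSet {m w : ℕ} (γ : ℕ → ℝ) {q : (ZMod p)[X]}
    (hq : q ∈ searchSet p m w (X ^ m)) :
    Rsum p m (X ^ m) γ (fun _ : Fin 1 => X ^ w * q) =
      Rsum p m (X ^ m) γ (fun _ : Fin 1 => X ^ w) := by
  rcases le_or_gt m w with hw | hw
  · rw [searchSet, if_neg hw.not_gt, Set.mem_singleton_iff] at hq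
    rw [hq, mul_one]
  · classical
    unfold Rsum
    refine sum_congr (filter_congr fun h _ => and_congr_right' ?_) fun _ _ => rfl
    rw [univ_unique, sum_singleton, sum_singleton, ← mul_assoc]
    exact X_pow_dvd_mul_iff_of_mem_searchFinset hw (mem_searchFinset.2 hq) m

/-- `IsReducedCBC` fixes the first component without comparing it, but there all candidates are
equally good. -/
theorem IsReducedCBC.Rsum_initial_le {m : ℕ} {γ : ℕ → ℝ} {w : ℕ → ℕ} {s : ℕ}
    {g : Fin s → (ZMod p)[X]} (hg : IsReducedCBC p m (X ^ m) γ w g) (d : Fin s) {q : (ZMod p)[X]}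
    (hq : q ∈ searchSet p m (w d) (X ^ m)) :
    Rsum p m (X ^ m) γ (initial (genVector w g) d) ≤
      Rsum p m (X ^ m) γ (initial (genVector w (Function.update g d q)) d) := by
  obtain ⟨d, hd⟩ := d
  cases d with
  | succ d => exact hg.minimal _ (Nat.le_add_left 1 d) q hq
  | zero =>
    have hone (g : Fin s → (ZMod p)[X]) : initial (genVector w g) ⟨0, hd⟩ =
        fun _ : Fin 1 => X ^ w 0 * g ⟨0, hd⟩ :=
      funext fun i => by rw [Fin.fin_one_eq_zero i]; rfl
    rw [hone, hone, Function.update_self, Rsum_X_pow_mul_of_mem_searchSet γ (hg.mem ⟨0, hd⟩),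
      Rsum_X_pow_mul_of_mem_searchSet γ hq]

theorem IsReducedCBC.Rsum_take_le {m : ℕ} {γ : ℕ → ℝ} (hγ : ∀ j, 0 ≤ γ j) {w : ℕ → ℕ} {s : ℕ}
    {g : Fin s → (ZMod p)[X]} (hg : IsReducedCBC p m (X ^ m) γ w g) (n : ℕ) (hn : n ≤ s) :
    Rsum p m (X ^ m) γ (Fin.take n hn (genVector w g)) ≤
      (∏ i : Fin n, (1 + γ i + γ i * ((p : ℝ) ^ w i * (p * (m * sinSum p))))) / (p : ℝ) ^ m := by
  have hp : (1 : ℝ) ≤ p := by exact_mod_cast NeZero.one_le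
  have hA : 0 ≤ m * sinSum p := mul_nonneg m.cast_nonneg sinSum_nonneg
  set A := m * sinSum p
  induction n with
  | zero =>
    classical
    rw [Rsum, sum_eq_zero]
    · positivity
    · exact fun h hh => absurd (Subsingleton.elim h 0) (mem_filter.1 hh).2.1
  | succ n ih =>
    have hprod : ∏ i : Fin n, (1 + γ i + γ i * A) ≤
        ∏ i : Fin n, (1 + γ i + γ i * ((p : ℝ) ^ w i * (p * A))) := by
      simpa only [mul_assoc] using prod_one_add_add_mul_le_prod (fun i : Fin n => hγ i)
        (fun i => one_le_mul_of_one_le_of_one_le (one_le_pow₀ (n := w i) hp) hp) hA univ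
    set P := ∏ i : Fin n, (1 + γ i + γ i * ((p : ℝ) ^ w i * (p * A)))
    have hγn := hγ n
    calc Rsum p m (X ^ m) γ (Fin.take (n + 1) hn (genVector w g))
        ≤ (1 + γ n) * Rsum p m (X ^ m) γ (Fin.take n (Nat.le_of_succ_le hn) (genVector w g)) +
          γ n * ((∏ i : Fin n, (1 + γ i + γ i * A)) *
            ((p : ℝ) ^ w n * (p * A) / (p : ℝ) ^ m)) := by
          refine le_of_forall_le_Rsum_snoc m (w n) hγ _ fun q hq => ?_
          have hmin := hg.Rsum_initial_le ⟨n, hn⟩ hq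
          rwa [genVector_update, initial_update] at hmin
      _ ≤ (1 + γ n) * (P / (p : ℝ) ^ m) +
          γ n * (P * ((p : ℝ) ^ w n * (p * A) / (p : ℝ) ^ m)) := by
        gcongr
        exact ih _
      _ = _ := by
        rw [Fin.prod_univ_castSucc]
        simp only [Fin.val_castSucc, Fin.val_last]
        ring

theorem IsReducedCBC.Rsum_le {m : ℕ} {γ : ℕ → ℝ} (hγ : ∀ j, 0 ≤ γ j) {w : ℕ → ℕ} {s : ℕ}
    {g : Fin s → (ZMod p)[X]} (hg : IsReducedCBC p m (X ^ m) γ w g) :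
    Rsum p m (X ^ m) γ (genVector w g) ≤
      (∏ i : Fin s, (1 + γ i + γ i * ((p : ℝ) ^ w i * (p * (m * sinSum p))))) / (p : ℝ) ^ m := by
  simpa only [Fin.take_eq_self] using hg.Rsum_take_le hγ s le_rfl

theorem genVector_snoc (w : ℕ → ℕ) {s : ℕ} (g : Fin s → (ZMod p)[X]) (q : (ZMod p)[X]) :
    genVector w (Fin.snoc g q : Fin (s + 1) → (ZMod p)[X]) =
      Fin.snoc (genVector w g) (X ^ w s * q) := by
  funext i
  induction i using Fin.lastCases <;> simp [genVector]

theorem IsReducedCBC.snoc {m : ℕ} {f : (ZMod p)[X]} {γ : ℕ → ℝ} {w : ℕ → ℕ} {s : ℕ}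
    {g : Fin s → (ZMod p)[X]} (hg : IsReducedCBC p m f γ w g) {q : (ZMod p)[X]}
    (hq : q ∈ searchSet p m (w s) f) (hfirst : s = 0 → q = 1)
    (hmin : 1 ≤ s → ∀ q' ∈ searchSet p m (w s) f,
      Rsum p m f γ (genVector w (Fin.snoc g q : Fin (s + 1) → (ZMod p)[X])) ≤
        Rsum p m f γ (genVector w (Fin.snoc g q' : Fin (s + 1) → (ZMod p)[X]))) :
    IsReducedCBC p m f γ w (Fin.snoc g q : Fin (s + 1) → (ZMod p)[X]) where
  mem d := by
    induction d using Fin.lastCases with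
    | last => simpa using hq
    | cast d => simpa using hg.mem d
  first d hd := by
    induction d using Fin.lastCases with
    | last => simpa using hfirst hd
    | cast d => simpa using hg.first d hd
  minimal d hd q' hq' := by
    induction d using Fin.lastCases with
    | last =>
      rw [Fin.update_snoc_last]
      exact hmin hd q' hq'
    | cast d =>
      rw [← Fin.snoc_update, genVector_snoc, genVector_snoc, initial_snoc_castSucc,
        initial_snoc_castSucc]
      exact hg.minimal d hd q' (by simpa using hq')

theorem exists_isReducedCBC (m : ℕ) (f : (ZMod p)[X]) (γ : ℕ → ℝ) (w : ℕ → ℕ) (s : ℕ) :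
    ∃ g : Fin s → (ZMod p)[X], IsReducedCBC p m f γ w g := by
  induction s with
  | zero => exact ⟨Fin.elim0, fun d => d.elim0, fun d => d.elim0, fun d => d.elim0⟩
  | succ s ih =>
    obtain ⟨g, hg⟩ := ih
    rcases s.eq_zero_or_pos with rfl | hs
    · exact ⟨_, hg.snoc (one_mem_searchSet m _ f) (fun _ => rfl) fun h => absurd h (by simp)⟩
    · obtain ⟨q, hq, hmin⟩ := Set.exists_min_image (searchSet p m (w s) f)
        (fun q => Rsum p m f γ (genVector w (Fin.snoc g q : Fin (s + 1) → (ZMod p)[X])))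
        (searchSet_finite m _ f) ⟨1, one_mem_searchSet m _ f⟩
      exact ⟨_, hg.snoc hq (fun h => absurd h hs.ne') fun _ => hmin⟩

end Construction

section Growth

variable {ι : Type*} {a : ι → ℝ}

theorem prod_one_add_mul_le_prod_mul_exp (ha : ∀ i, 0 ≤ a i) (T : Finset ι) {c x : ℝ}
    (hc : 0 < c) (hx : 0 ≤ x) :
    ∏ i ∈ T, (1 + x * a i) ≤ (∏ i ∈ T, (1 + a i / c)) * Real.exp (x * (#T * c)) := by
  have hfac (i) : 1 + x * a i ≤ (1 + a i / c) * Real.exp (x * c) := by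
    have hai := ha i
    calc 1 + x * a i ≤ (1 + a i / c) * (x * c + 1) := by
          have h1 : 0 ≤ a i / c + x * c := by positivity
          have h2 : a i / c * (x * c) = x * a i := by field_simp
          linarith
      _ ≤ _ := by gcongr; exact Real.add_one_le_exp _
  calc ∏ i ∈ T, (1 + x * a i) ≤ ∏ i ∈ T, ((1 + a i / c) * Real.exp (x * c)) :=
        prod_le_prod (fun i _ => by have := ha i; positivity) fun i _ => hfac i
    _ = _ := by rw [prod_mul_distrib, prod_const, ← Real.exp_nat_mul, mul_left_comm x]

/-- The finitely many factors outside of which `a` has small sum grow only polynomially. -/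
theorem exists_prod_one_add_mul_le (ha : ∀ i, 0 ≤ a i) (hs : Summable a) {η : ℝ} (hη : 0 < η) :
    ∃ C > (0 : ℝ), ∀ x : ℝ, 0 ≤ x → ∀ u : Finset ι,
      ∏ i ∈ u, (1 + x * a i) ≤ C * Real.exp (x * η) := by
  classical
  obtain ⟨T, hT⟩ := summable_iff_vanishing_norm.1 hs (η / 2) (by positivity)
  set c : ℝ := η / (2 * (#T + 1))
  have hc : 0 < c := by positivity
  have hTc : #T * c ≤ η / 2 := by
    rw [mul_div_assoc', div_le_div_iff₀ (by positivity) (by positivity)]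
    nlinarith
  set C := ∏ i ∈ T, (1 + a i / c)
  have hC : 0 < C := prod_pos fun i _ => by have := ha i; positivity
  refine ⟨C, hC, fun x hx u => ?_⟩
  have hone (i) : 1 ≤ 1 + x * a i := le_add_of_nonneg_right (mul_nonneg hx (ha i))
  have hoff : ∏ i ∈ u \ T, (1 + x * a i) ≤ Real.exp (x * (η / 2)) := by
    refine (Real.prod_one_add_le_exp_sum _ fun i => mul_nonneg hx (ha i)).trans ?_
    rw [← mul_sum]
    gcongr
    exact (le_abs_self _).trans (hT _ sdiff_disjoint).le
  calc ∏ i ∈ u, (1 + x * a i) ≤ ∏ i ∈ u ∪ T, (1 + x * a i) :=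
        prod_mono_set_of_one_le hone subset_union_left
    _ = (∏ i ∈ u \ T, (1 + x * a i)) * ∏ i ∈ T, (1 + x * a i) := by
        rw [← prod_sdiff subset_union_right, union_sdiff_right]
    _ ≤ Real.exp (x * (η / 2)) * (C * Real.exp (x * (#T * c))) :=
        mul_le_mul hoff (prod_one_add_mul_le_prod_mul_exp ha T hc hx)
          (prod_nonneg fun i _ => zero_le_one.trans (hone i)) (Real.exp_pos _).le
    _ ≤ Real.exp (x * (η / 2)) * (C * Real.exp (x * (η / 2))) := by gcongr
    _ = C * Real.exp (x * η) := by rw [mul_left_comm, ← Real.exp_add, ← mul_add, add_halves]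

theorem prod_mul_card_le_exp (ha : ∀ i, 0 ≤ a i) (hs : Summable a) (u : Finset ι) :
    (∏ i ∈ u, a i) * #u ≤ Real.exp (2 * ∑' i, a i) :=
  calc (∏ i ∈ u, a i) * #u ≤ (∏ i ∈ u, a i) * 2 ^ #u := by
        gcongr
        · exact prod_nonneg fun i _ => ha i
        · exact_mod_cast Nat.lt_two_pow_self.le
    _ = ∏ i ∈ u, 2 * a i := by rw [prod_mul_distrib, prod_const, mul_comm]
    _ ≤ ∏ i ∈ u, (1 + 2 * a i) :=
        prod_le_prod (fun i _ => mul_nonneg zero_le_two (ha i)) fun i _ => by linarith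
    _ ≤ Real.exp (∑ i ∈ u, 2 * a i) :=
        Real.prod_one_add_le_exp_sum _ fun i => mul_nonneg zero_le_two (ha i)
    _ ≤ _ := by
        rw [← mul_sum]
        gcongr
        exact hs.sum_le_tsum _ fun i _ => ha i

end Growth

section Rate

theorem weightedStarDisc_nonneg {γ : ℕ → ℝ} (hγ : ∀ j, 0 ≤ γ j) {N s : ℕ}
    (P : Fin N → Fin s → ℝ) : 0 ≤ weightedStarDisc γ P :=
  Real.iSup_nonneg fun _ => Real.iSup_nonneg fun _ =>
    mul_nonneg (prod_nonneg fun j _ => hγ j) (abs_nonneg _)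

theorem minDisc_le {γ : ℕ → ℝ} (hγ : ∀ j, 0 ≤ γ j) {N s : ℕ} {P : Fin N → Fin s → ℝ}
    (hP : ∀ n j, P n j ∈ Set.Ico (0 : ℝ) 1) : minDisc γ N s ≤ weightedStarDisc γ P :=
  ciInf_le (f := fun P : Fin N → Fin s → Set.Ico (0 : ℝ) 1 =>
      weightedStarDisc γ fun n j => (P n j : ℝ))
    ⟨0, Set.forall_mem_range.2 fun _ => weightedStarDisc_nonneg hγ _⟩ fun n j => ⟨P n j, hP n j⟩

theorem infoComplexity_le {γ : ℕ → ℝ} (hγ : ∀ j, 0 ≤ γ j) {N s : ℕ} (hN : 1 ≤ N)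
    {P : Fin N → Fin s → ℝ} (hP : ∀ n j, P n j ∈ Set.Ico (0 : ℝ) 1) {ε : ℝ}
    (hε : weightedStarDisc γ P ≤ ε) : infoComplexity γ s ε ≤ N :=
  iInf_le (fun N : {N : ℕ // 1 ≤ N ∧ minDisc γ N s ≤ ε} => (N.1 : ℕ∞))
    ⟨N, hN, (minDisc_le hγ hP).trans hε⟩

variable {p : ℕ} [Fact p.Prime] {γ : ℕ → ℝ} {w : ℕ → ℕ}

theorem summable_of_summable_mul_pow (hγ : ∀ j, 0 ≤ γ j)
    (hsum : Summable fun j => γ j * (p : ℝ) ^ w j) : Summable γ :=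
  hsum.of_nonneg_of_le hγ fun j =>
    le_mul_of_one_le_right (hγ j) (one_le_pow₀ (by exact_mod_cast NeZero.one_le))

theorem IsReducedCBC.exists_Rsum_le (hγ : ∀ j, 0 ≤ γ j)
    (hsum : Summable fun j => γ j * (p : ℝ) ^ w j) {δ : ℝ} (hδ : 0 < δ) :
    ∃ C > (0 : ℝ), ∀ m s : ℕ, ∀ g : Fin s → (ZMod p)[X], IsReducedCBC p m (X ^ m) γ w g →
      Rsum p m (X ^ m) γ (genVector w g) ≤ C * ((p : ℝ) ^ m) ^ (-1 + δ) := by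
  have hp : (1 : ℝ) < p := by exact_mod_cast (Fact.out : p.Prime).one_lt
  have hS := sinSum_nonneg (p := p)
  set a : ℕ → ℝ := fun j => γ j * (p : ℝ) ^ w j * (1 + p * sinSum p)
  have ha (j) : 0 ≤ a j := by have := hγ j; positivity
  obtain ⟨C, hC, hprod⟩ := exists_prod_one_add_mul_le ha (hsum.mul_right _)
    (mul_pos hδ (Real.log_pos hp))
  refine ⟨C * p ^ δ, by positivity, fun m s g hg => ?_⟩
  have hfac (j : ℕ) : 1 + γ j + γ j * ((p : ℝ) ^ w j * (p * (m * sinSum p))) ≤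
      1 + (m + 1) * a j := by
    have hγj := hγ j
    have h1 : γ j ≤ γ j * (p : ℝ) ^ w j := le_mul_of_one_le_right hγj (one_le_pow₀ hp.le)
    have h2 : 0 ≤ γ j * (p : ℝ) ^ w j * (m + p * sinSum p) := by positivity
    simp only [a]
    linarith
  have hexp : Real.exp ((m + 1) * (δ * Real.log p)) = p ^ δ * ((p : ℝ) ^ m) ^ δ := by
    rw [← Real.mul_rpow (by positivity) (by positivity), Real.rpow_def_of_pos (by positivity),
      Real.log_mul (by positivity) (by positivity), Real.log_pow]
    ring_nf
  calc Rsum p m (X ^ m) γ (genVector w g)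
      ≤ (∏ i : Fin s, (1 + γ i + γ i * ((p : ℝ) ^ w i * (p * (m * sinSum p))))) / (p : ℝ) ^ m :=
        hg.Rsum_le hγ
    _ ≤ (∏ i ∈ range s, (1 + (m + 1) * a i)) / (p : ℝ) ^ m := by
        rw [prod_range]
        refine div_le_div_of_nonneg_right (prod_le_prod (fun i _ => ?_) fun i _ => hfac i)
          (by positivity)
        have := hγ i
        positivity
    _ ≤ C * Real.exp ((m + 1) * (δ * Real.log p)) / (p : ℝ) ^ m := by
        gcongr
        exact hprod _ (by positivity) _
    _ = _ := by
        rw [hexp, Real.rpow_add (by positivity), Real.rpow_neg_one]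
        ring

theorem IsReducedCBC.exists_weightedStarDisc_le (hγ : ∀ j, 0 ≤ γ j)
    (hsum : Summable fun j => γ j * (p : ℝ) ^ w j) {δ : ℝ} (hδ : 0 < δ) :
    ∃ C > (0 : ℝ), ∀ m s : ℕ, ∀ g : Fin s → (ZMod p)[X], IsReducedCBC p m (X ^ m) γ w g →
      weightedStarDisc γ (polyLatticePoints p m (X ^ m) (genVector w g)) ≤
        C * ((p : ℝ) ^ m) ^ (-1 + δ) := by
  have hp : (1 : ℝ) ≤ p := by exact_mod_cast NeZero.one_le
  obtain ⟨C, hC, hR⟩ := IsReducedCBC.exists_Rsum_le hγ hsum hδ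
  set E := Real.exp (2 * ∑' j, γ j)
  have hE {s : ℕ} (u : Finset (Fin s)) : (∏ j ∈ u, γ j) * #u ≤ E := by
    simpa using prod_mul_card_le_exp hγ (summable_of_summable_mul_pow hγ hsum)
      (u.map Fin.valEmbedding)
  refine ⟨C + E, add_pos hC (Real.exp_pos _), fun m s g hg => ?_⟩
  have hN : (1 : ℝ) ≤ (p : ℝ) ^ m := one_le_pow₀ hp
  calc weightedStarDisc γ (polyLatticePoints p m (X ^ m) (genVector w g))
      ≤ Rsum p m (X ^ m) γ (genVector w g) + E / (p : ℝ) ^ m := weightedStarDisc_le hγ _ hE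
    _ ≤ C * ((p : ℝ) ^ m) ^ (-1 + δ) + E * ((p : ℝ) ^ m) ^ (-1 + δ) := by
        rw [div_eq_mul_inv, ← Real.rpow_neg_one]
        gcongr
        · exact hR m s g hg
        · linarith
    _ = _ := (add_mul _ _ _).symm

theorem mul_rpow_neg_half_le {C N ε : ℝ} (hε : 0 < ε) (hN : C ^ 2 * (ε ^ 2)⁻¹ ≤ N)
    (hN0 : 0 < N) : C * N ^ (-1 + 1 / 2 : ℝ) ≤ ε := by
  have hsqrt : C / ε ≤ √N := Real.le_sqrt_of_sq_le (by rwa [div_pow, div_eq_mul_inv])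
  rw [show (-1 + 1 / 2 : ℝ) = -(1 / 2) by norm_num, Real.rpow_neg hN0.le, ← Real.sqrt_eq_rpow,
    ← div_eq_mul_inv, div_le_iff₀ (Real.sqrt_pos.2 hN0), mul_comm]
  exact (div_le_iff₀ hε).1 hsqrt

theorem IsReducedCBC.exists_pow_le_and_weightedStarDisc_le (hγ : ∀ j, 0 ≤ γ j)
    (hsum : Summable fun j => γ j * (p : ℝ) ^ w j) :
    ∃ C > (0 : ℝ), ∃ τ > (0 : ℝ), ∀ s : ℕ, ∀ ε ∈ Set.Ioo (0 : ℝ) 1,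
      ∃ m : ℕ, 1 ≤ m ∧ (p : ℝ) ^ m ≤ C * ε ^ (-τ) ∧ ∀ g : Fin s → (ZMod p)[X],
        IsReducedCBC p m (X ^ m) γ w g →
          weightedStarDisc γ (polyLatticePoints p m (X ^ m) (genVector w g)) ≤ ε := by
  have hp : (1 : ℝ) < p := by exact_mod_cast (Fact.out : p.Prime).one_lt
  obtain ⟨C, -, hrate⟩ := IsReducedCBC.exists_weightedStarDisc_le hγ hsum one_half_pos
  refine ⟨p * max 1 (C ^ 2), by positivity, 2, two_pos, fun s ε ⟨hε0, hε1⟩ => ?_⟩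
  have hone : 1 ≤ max 1 (C ^ 2) * (ε ^ 2)⁻¹ :=
    one_le_mul_of_one_le_of_one_le (le_max_left _ _)
      ((one_le_inv₀ (by positivity)).2 (pow_le_one₀ hε0.le hε1.le))
  obtain ⟨n, hle, hlt⟩ := exists_nat_pow_near hone hp
  refine ⟨n + 1, Nat.le_add_left 1 n, ?_, fun g hg => (hrate (n + 1) s g hg).trans ?_⟩
  · rw [Real.rpow_neg hε0.le, Real.rpow_two, pow_succ', mul_assoc]
    gcongr
  · refine mul_rpow_neg_half_le hε0 (le_trans ?_ hlt.le) (by positivity)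
    gcongr
    exact le_max_right _ _

theorem stronglyPolynomiallyTractable_of_summable (hγ : ∀ j, 0 ≤ γ j)
    (hsum : Summable fun j => γ j * (p : ℝ) ^ w j) : StronglyPolynomiallyTractable γ := by
  obtain ⟨C, hC, τ, hτ, h⟩ := IsReducedCBC.exists_pow_le_and_weightedStarDisc_le hγ hsum
  refine ⟨C, hC, τ, hτ, fun s _ ε hε => ?_⟩
  obtain ⟨m, -, hpm, hdisc⟩ := h s ε hε
  obtain ⟨g, hg⟩ := exists_isReducedCBC m (X ^ m : (ZMod p)[X]) γ w s
  calc (infoComplexity γ s ε : ℝ≥0∞) ≤ (((p ^ m : ℕ) : ℕ∞) : ℝ≥0∞) :=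
        ENat.toENNReal_le.2 (infoComplexity_le hγ (Nat.one_le_pow _ _ (NeZero.pos p))
          (polyLatticePoints_mem_Ico m _) (hdisc g hg))
    _ = ENNReal.ofReal ((p : ℝ) ^ m) := by
        rw [ENat.toENNReal_coe, ← Nat.cast_pow, ENNReal.ofReal_natCast]
    _ ≤ _ := ENNReal.ofReal_le_ofReal hpm

end Rate

end PolyLattice

theorem mainTheorem4_general (p : ℕ) [Fact p.Prime] (γ : ℕ → ℝ) (hγ : ∀ j, 0 ≤ γ j)
    (w : ℕ → ℕ) (hsum : Summable fun j => γ j * (p : ℝ) ^ w j) :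
    (∀ m s : ℕ, 1 ≤ m → 1 ≤ s → ∃ g : Fin s → Polynomial (ZMod p),
      PolyLattice.IsReducedCBC p m (Polynomial.X ^ m) γ w g) ∧
    PolyLattice.StronglyPolynomiallyTractable γ ∧
    (∃ C > (0 : ℝ), ∃ τ > (0 : ℝ), ∀ s : ℕ, 1 ≤ s → ∀ ε ∈ Set.Ioo (0 : ℝ) 1,
      ∃ m : ℕ, 1 ≤ m ∧ (p : ℝ) ^ m ≤ C * ε ^ (-τ) ∧
        ∀ g : Fin s → Polynomial (ZMod p),
          PolyLattice.IsReducedCBC p m (Polynomial.X ^ m) γ w g →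
          PolyLattice.weightedStarDisc γ
            (PolyLattice.polyLatticePoints p m (Polynomial.X ^ m)
              (PolyLattice.genVector w g)) ≤ ε) ∧
    (∀ δ > (0 : ℝ), ∃ C > (0 : ℝ), ∀ m s : ℕ, 1 ≤ m → 1 ≤ s →
      ∀ g : Fin s → Polynomial (ZMod p),
        PolyLattice.IsReducedCBC p m (Polynomial.X ^ m) γ w g →
        PolyLattice.weightedStarDisc γ
          (PolyLattice.polyLatticePoints p m (Polynomial.X ^ m)
            (PolyLattice.genVector w g)) ≤ C * ((p : ℝ) ^ m) ^ (-1 + δ)) := by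
  obtain ⟨C, hC, τ, hτ, hattain⟩ :=
    PolyLattice.IsReducedCBC.exists_pow_le_and_weightedStarDisc_le hγ hsum
  refine ⟨fun m s _ _ => PolyLattice.exists_isReducedCBC m _ γ w s,
    PolyLattice.stronglyPolynomiallyTractable_of_summable hγ hsum,
    ⟨C, hC, τ, hτ, fun s _ => hattain s⟩, fun δ hδ => ?_⟩
  obtain ⟨C, hC, hrate⟩ := PolyLattice.IsReducedCBC.exists_weightedStarDisc_le hγ hsum hδ
  exact ⟨C, hC, fun m s _ _ => hrate m s⟩

theorem mainTheorem4 (p : ℕ) [Fact p.Prime]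
    (γ : ℕ → ℝ) (hγ_pos : ∀ j, 0 < γ j) (hγ_le : ∀ j, γ j ≤ 1) (hγ_anti : Antitone γ)
    (w : ℕ → ℕ) (hw_zero : w 0 = 0) (hw_mono : Monotone w)
    (hsum : Summable fun j => γ j * (p : ℝ) ^ w j) :
    -- the algorithm always has an output
    (∀ m s : ℕ, 1 ≤ m → 1 ≤ s → ∃ g : Fin s → Polynomial (ZMod p),
      PolyLattice.IsReducedCBC p m (Polynomial.X ^ m) γ w g) ∧
    -- strong polynomial tractability
    PolyLattice.StronglyPolynomiallyTractable γ ∧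
    -- it is achieved by the point sets that the algorithm constructs
    (∃ C > (0 : ℝ), ∃ τ > (0 : ℝ), ∀ s : ℕ, 1 ≤ s → ∀ ε ∈ Set.Ioo (0 : ℝ) 1,
      ∃ m : ℕ, 1 ≤ m ∧ (p : ℝ) ^ m ≤ C * ε ^ (-τ) ∧
        ∀ g : Fin s → Polynomial (ZMod p),
          PolyLattice.IsReducedCBC p m (Polynomial.X ^ m) γ w g →
          PolyLattice.weightedStarDisc γ
            (PolyLattice.polyLatticePoints p m (Polynomial.X ^ m)
              (PolyLattice.genVector w g)) ≤ ε) ∧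
    -- the rate, with a constant that depends neither on `s` nor on `m`
    (∀ δ > (0 : ℝ), ∃ C > (0 : ℝ), ∀ m s : ℕ, 1 ≤ m → 1 ≤ s →
      ∀ g : Fin s → Polynomial (ZMod p),
        PolyLattice.IsReducedCBC p m (Polynomial.X ^ m) γ w g →
        PolyLattice.weightedStarDisc γ
          (PolyLattice.polyLatticePoints p m (Polynomial.X ^ m)
            (PolyLattice.genVector w g)) ≤ C * ((p : ℝ) ^ m) ^ (-1 + δ)) :=
  mainTheorem4_general p γ (fun j => (hγ_pos j).le) w hsum
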